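/- **Setting.** Let $0\le d<n$ and let $U\subset\mathbb R^{2n}$ be open, with real-analytic maps $a:U\to\mathbb R^{2n}$, $G,J:U\to\mathbb R^{2n\times 2n}$ such that, with $\Omega=(\mathrm Da)^\top-\mathrm Da$, at each point of $U$: $\det\Omega\ne0$, $G$ is symmetric positive definite, $J^2=-I$ and $J^\top\Omega=G$ (a compatible triple with exact symplectic form). Let $h_\lambda:U\to\mathbb R$, $\lambda\in\mathbb R^{n-d}$, be real-analytic, with $X_{h}(\cdot;\lambda)=\Omega^{-1}(\mathrm D_zh_\lambda)^\top$. Let $K:\mathbb T^d\to U$ and $W:\mathbb T^d\to\mathbb R^{2n\times2(n-d)}$ be real-analytic, $\mathbb T^d=\mathbb R^d/(2\pi\mathbb Z)^d$. For $\omega\in\mathbb R^d$ and $\alpha,\beta\in\mathbb R^{n-d}$ put $\mathfrak L_\omega u=-\mathrm Du\cdot\omega$, $\Gamma_{\alpha,\beta}=\begin{pmatrix}\mathrm{diag}(\alpha)&-\mathrm{diag}(\beta)\\ \mathrm{diag}(\beta)&\mathrm{diag}(\alpha)\end{pmatrix}$, and define the invariance errors $$E_K=\mathfrak L_\omega K+X_h\circ(K;\lambda),\qquad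 E_W=\mathfrak L_\omega W+\mathrm D_zX_h\circ(K;\lambda)\,W-W\,\Gamma_{\alpha,\beta}.$$ Write $\Omega_{V_1V_2}=V_1^\top(\Omega\circ K)V_2$ and $G_{V_1V_2}=V_1^\top(G\circ K)V_2$. Put $L=\mathrm DK$, assume that $G_{LL}(\theta)$ and $\Omega_{WW}(\theta)$ are invertible for every $\theta$, and let $$B=G_{LL}^{-1},\quad C=\Omega_{WW}^{-1}G_{WL}B,\quad A=\tfrac12C^\top\Omega_{WW}C,\quad N=LA+(J\circ K)LB+WC,\quad P=(L\ \ N\ \ W).$$ For $\rho>0$ let $\|f\|_\rho$ be the supremum of (the entries of) the holomorphic extension of $f$ over the strip $|\mathrm{Im}\,\theta_k|<\rho$ ($+\infty$ if there is no extension or it is unbounded). **Lemma.** (1) For all $\theta$, with $\Omega_d=\begin{pmatrix}O_d&-I_d\\ I_d&O_d\end{pmatrix}$, $$P^\top(\Omega\circ K)P=\begin{pmatrix}\Omega_d&0\\0&\Omega_{WW}\end{pmatrix}+E_{sym},$$ $$E_{sym}=\begin{pmatrix}\Omega_{LL}&\Omega_{LL}A+\Omega_{LW}C&\Omega_{LW}\\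 A^\top\Omega_{LL}-C^\top\Omega_{LW}^\top& A^\top\Omega_{LL}A+B^\top\Omega_{LL}B+A^\top\Omega_{LW}C-C^\top\Omega_{LW}^\top A&A^\top\Omega_{LW}\\ -\Omega_{LW}^\top&-\Omega_{LW}^\top A&0\end{pmatrix}.$$ (2) $E_{sym}=\mathcal O(E_K,E_W)$ in the following sense. Let $(\omega,\beta)$ satisfy the Diophantine-Melnikov conditions of type $(\gamma,\tau)$, $\gamma>0$, $\tau>d-1$: $\beta_i\neq0$ for all $i$, $|\beta_i|\ne|\beta_j|$ for $i\ne j$, and for all $k\in\mathbb Z^d\setminus\{0\}$: $|k\cdot\omega|\ge\gamma|k|_1^{-\tau}$, $|k\cdot\omega-\beta_i|\ge\gamma|k|_1^{-\tau}$ for all $i$, and $|k\cdot\omega-\beta_i\pm\beta_j|\ge\gamma|k|_1^{-\tau}$ for $i\ne j$. Let $0<\rho'<\rho$ and $M\ge0$. Then there is a constant $c$, depending only on $n,d,\omega,\beta,\gamma,\tau,\rho,\rho',M$, such that for all data $(U,a,G,J,h)$, $\lambda,\alpha,K,W$ as above for which the norms $\|\cdot\|_\rho$ of $L$, $W$, $B$,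 $\Omega_{WW}^{-1}$, $\Omega\circ K$, $G\circ K$ and of the first partial derivatives of $\Omega$ composed with $K$ are at most $M$, $$\|E_{sym}\|_{\rho'}\le c\,\bigl(\|E_K\|_\rho+\|E_W\|_\rho\bigr).$$ -/

import Mathlib

open scoped ENNReal NNReal Matrix

noncomputable section

namespace EllipticTorus

/-! ### Analytic functions on the torus

A function on `𝕋^d = ℝ^d / (2πℤ)^d` is a function of `θ : Fin d → ℝ` that is `2π`-periodic in each
variable. -/

/-- Real-analytic functions on the torus `𝕋^d`. -/
def IsTorusAnalytic {d : ℕ} (f : (Fin d → ℝ) → ℝ) : Prop :=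
  AnalyticOnNhd ℝ f Set.univ ∧ ∀ θ k, f (θ + Pi.single k (2 * Real.pi)) = f θ

/-- The complex strip `|Im θ_k| < ρ` of width `ρ` around `ℝ^d`. -/
def strip (d : ℕ) (ρ : ℝ) : Set (Fin d → ℂ) := {θ | ∀ k, |(θ k).im| < ρ}

/-- `F` is a holomorphic extension of `f` to the strip of width `ρ`. -/
def IsHolomorphicExtension {d : ℕ} (ρ : ℝ) (f : (Fin d → ℝ) → ℝ) (F : (Fin d → ℂ) → ℂ) : Prop :=
  DifferentiableOn ℂ F (strip d ρ) ∧ ∀ x : Fin d → ℝ, F (fun k => (x k : ℂ)) = (f x : ℂ)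

/-- The norm `‖f‖_ρ` of the scale of Banach spaces of analytic functions: the supremum, over the
strip of width `ρ`, of the modulus of the holomorphic extension of `f`. For `0 < ρ` the extension
is unique when it exists; the norm is `∞` when there is none or when it is unbounded. -/
def stripNorm {d : ℕ} (ρ : ℝ) (f : (Fin d → ℝ) → ℝ) : ℝ≥0∞ :=
  ⨅ (F : (Fin d → ℂ) → ℂ) (_ : IsHolomorphicExtension ρ f F), ⨆ θ ∈ strip d ρ, ‖F θ‖ₑ

/-- `‖·‖_ρ` for vector functions (maximum over the components). -/
def stripNormVec {d : ℕ} {ι : Type*} (ρ : ℝ) (f : (Fin d → ℝ) → ι → ℝ) : ℝ≥0∞ :=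
  ⨆ i, stripNorm ρ (fun θ => f θ i)

/-- `‖·‖_ρ` for matrix functions (maximum over the entries). -/
def stripNormMat {d : ℕ} {ι κ : Type*} (ρ : ℝ) (A : (Fin d → ℝ) → Matrix ι κ ℝ) : ℝ≥0∞ :=
  ⨆ (i) (j), stripNorm ρ (fun θ => A θ i j)

/-- The operator `𝔏_ω u = - D u · ω`. -/
def lieOp {d : ℕ} (ω : Fin d → ℝ) (u : (Fin d → ℝ) → ℝ) (θ : Fin d → ℝ) : ℝ := -(fderiv ℝ u θ ω)

/-- Partial derivative with respect to the `j`-th coordinate. -/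
def pderiv {ι : Type*} [Fintype ι] [DecidableEq ι] (j : ι) (f : (ι → ℝ) → ℝ) (x : ι → ℝ) : ℝ :=
  fderiv ℝ f x (Pi.single j 1)

/-- The Jacobian matrix `D f (x)`. -/
def jacobian {ι κ : Type*} [Fintype ι] [DecidableEq ι] (f : (ι → ℝ) → κ → ℝ) (x : ι → ℝ) :
    Matrix κ ι ℝ :=
  Matrix.of fun i j => pderiv j (fun y => f y i) x

/-! ### The phase space -/

/-- The matrix `Ω = (D a)ᵀ - D a` of the exact 2-form with primitive `∑ i, a_i dz_i`. -/
def symplMatrix {n : ℕ} (a : (Fin (2 * n) → ℝ) → Fin (2 * n) → ℝ) (z : Fin (2 * n) → ℝ) :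
    Matrix (Fin (2 * n)) (Fin (2 * n)) ℝ :=
  (jacobian a z)ᵀ - jacobian a z

/-- An open set `U ⊆ ℝ^{2n}` with an analytic exact symplectic form (of matrix `Ω`), an analytic
Riemannian metric (of matrix `G`) and an analytic almost complex structure (of matrix `J`) that
form a compatible triple, `ω(J u, v) = g(u, v)`. -/
structure PhaseSpace (n : ℕ) where
  U : Set (Fin (2 * n) → ℝ)
  isOpen_U : IsOpen U
  a : (Fin (2 * n) → ℝ) → Fin (2 * n) → ℝ
  G : (Fin (2 * n) → ℝ) → Matrix (Fin (2 * n)) (Fin (2 * n)) ℝ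
  J : (Fin (2 * n) → ℝ) → Matrix (Fin (2 * n)) (Fin (2 * n)) ℝ
  analytic_a : ∀ i, AnalyticOnNhd ℝ (fun z => a z i) U
  analytic_G : ∀ i j, AnalyticOnNhd ℝ (fun z => G z i j) U
  analytic_J : ∀ i j, AnalyticOnNhd ℝ (fun z => J z i j) U
  nondegenerate : ∀ z ∈ U, (symplMatrix a z).det ≠ 0
  posDef_G : ∀ z ∈ U, (G z).PosDef
  J_mul_J : ∀ z ∈ U, J z * J z = -1
  compatible : ∀ z ∈ U, (J z)ᵀ * symplMatrix a z = G z

/-- The matrix `Ω(z)` of the symplectic form. -/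
def PhaseSpace.Om {n : ℕ} (S : PhaseSpace n) (z : Fin (2 * n) → ℝ) :
    Matrix (Fin (2 * n)) (Fin (2 * n)) ℝ :=
  symplMatrix S.a z

/-- The Hamiltonian vector field `X_h = Ω⁻¹ (D h)ᵀ`. -/
def PhaseSpace.hamVF {n : ℕ} (S : PhaseSpace n) (h : (Fin (2 * n) → ℝ) → ℝ)
    (z : Fin (2 * n) → ℝ) : Fin (2 * n) → ℝ :=
  (S.Om z)⁻¹ *ᵥ fun i => pderiv i h z

/-! ### Frequencies -/

/-- Diophantine-Melnikov conditions of type `(γ, τ)` on `(ω, β)`, with `|k|₁ = ∑ |k_l|`. -/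
structure DiophantineMelnikov {d m : ℕ} (ω : Fin d → ℝ) (β : Fin m → ℝ) (γ τ : ℝ) : Prop where
  γ_pos : 0 < γ
  τ_gt : (d : ℝ) - 1 < τ
  β_ne_zero : ∀ i, β i ≠ 0
  β_distinct : ∀ i j, i ≠ j → |β i| ≠ |β j|
  diophantine : ∀ k : Fin d → ℤ, k ≠ 0 →
    γ / (∑ l, |(k l : ℝ)|) ^ τ ≤ |∑ l, (k l : ℝ) * ω l|
  melnikov_one : ∀ k : Fin d → ℤ, k ≠ 0 → ∀ i,
    γ / (∑ l, |(k l : ℝ)|) ^ τ ≤ |(∑ l, (k l : ℝ) * ω l) - β i|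
  melnikov_two : ∀ k : Fin d → ℤ, k ≠ 0 → ∀ i j, i ≠ j →
    γ / (∑ l, |(k l : ℝ)|) ^ τ ≤ |(∑ l, (k l : ℝ) * ω l) - β i + β j| ∧
    γ / (∑ l, |(k l : ℝ)|) ^ τ ≤ |(∑ l, (k l : ℝ) * ω l) - β i - β j|

/-- The matrix `Γ_{α,β}`. -/
def Gam {m : ℕ} (α β : Fin m → ℝ) : Matrix (Fin m ⊕ Fin m) (Fin m ⊕ Fin m) ℝ :=
  Matrix.fromBlocks (Matrix.diagonal α) (-Matrix.diagonal β) (Matrix.diagonal β)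
    (Matrix.diagonal α)

/-! ### Torus, normal bundle and invariance errors

`K : 𝕋^d → ℝ^{2n}` parametrizes the torus and `W : 𝕋^d → ℝ^{2n × 2m}`, with `m = n - d`, its normal
bundle; the `2m` columns of `W` are indexed by `Fin m ⊕ Fin m`. -/

variable {n d m : ℕ}

/-- The error `E_K = 𝔏_ω K + X_h ∘ K` in the invariance equation of the torus. -/
def errK (S : PhaseSpace n) (h : (Fin (2 * n) → ℝ) → ℝ) (ω : Fin d → ℝ)
    (K : (Fin d → ℝ) → Fin (2 * n) → ℝ) (θ : Fin d → ℝ) : Fin (2 * n) → ℝ :=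
  fun i => lieOp ω (fun t => K t i) θ + S.hamVF h (K θ) i

/-- The error `E_W = 𝔏_ω W + (D X_h ∘ K) W - W Γ_{α,β}` in the equation of the normal bundle. -/
def errW (S : PhaseSpace n) (h : (Fin (2 * n) → ℝ) → ℝ) (ω : Fin d → ℝ) (α β : Fin m → ℝ)
    (K : (Fin d → ℝ) → Fin (2 * n) → ℝ)
    (W : (Fin d → ℝ) → Matrix (Fin (2 * n)) (Fin m ⊕ Fin m) ℝ) (θ : Fin d → ℝ) :
    Matrix (Fin (2 * n)) (Fin m ⊕ Fin m) ℝ :=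
  (Matrix.of fun i j => lieOp ω (fun t => W t i j) θ)
    + jacobian (S.hamVF h) (K θ) * W θ - W θ * Gam α β

/-! ### The frame -/

section Frame

variable (S : PhaseSpace n) (K : (Fin d → ℝ) → Fin (2 * n) → ℝ)
  (W : (Fin d → ℝ) → Matrix (Fin (2 * n)) (Fin m ⊕ Fin m) ℝ)

/-- `Ω_{V₁V₂} = V₁ᵀ (Ω ∘ K) V₂`. -/
def OmPair {p q : Type*} (V₁ : (Fin d → ℝ) → Matrix (Fin (2 * n)) p ℝ)
    (V₂ : (Fin d → ℝ) → Matrix (Fin (2 * n)) q ℝ) (θ : Fin d → ℝ) : Matrix p q ℝ :=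
  (V₁ θ)ᵀ * S.Om (K θ) * V₂ θ

/-- `G_{V₁V₂} = V₁ᵀ (G ∘ K) V₂`. -/
def GPair {p q : Type*} (V₁ : (Fin d → ℝ) → Matrix (Fin (2 * n)) p ℝ)
    (V₂ : (Fin d → ℝ) → Matrix (Fin (2 * n)) q ℝ) (θ : Fin d → ℝ) : Matrix p q ℝ :=
  (V₁ θ)ᵀ * S.G (K θ) * V₂ θ

/-- `L = D K`. -/
def matL (θ : Fin d → ℝ) : Matrix (Fin (2 * n)) (Fin d) ℝ := jacobian K θ

/-- `B = G_{LL}⁻¹`. -/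
def matB (θ : Fin d → ℝ) : Matrix (Fin d) (Fin d) ℝ := (GPair S K (matL K) (matL K) θ)⁻¹

/-- `C = Ω_{WW}⁻¹ G_{WL} B`. -/
def matC (θ : Fin d → ℝ) : Matrix (Fin m ⊕ Fin m) (Fin d) ℝ :=
  (OmPair S K W W θ)⁻¹ * GPair S K W (matL K) θ * matB S K θ

/-- `A = ½ Cᵀ Ω_{WW} C`. -/
def matA (θ : Fin d → ℝ) : Matrix (Fin d) (Fin d) ℝ :=
  (1 / 2 : ℝ) • ((matC S K W θ)ᵀ * OmPair S K W W θ * matC S K W θ)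

/-- `N = L A + (J ∘ K) L B + W C`. -/
def matN (θ : Fin d → ℝ) : Matrix (Fin (2 * n)) (Fin d) ℝ :=
  matL K θ * matA S K W θ + S.J (K θ) * matL K θ * matB S K θ + W θ * matC S K W θ

/-- The frame `P = (L N W)`. -/
def frameP (θ : Fin d → ℝ) : Matrix (Fin (2 * n)) ((Fin d ⊕ Fin d) ⊕ (Fin m ⊕ Fin m)) ℝ :=
  Matrix.fromCols (Matrix.fromCols (matL K θ) (matN S K W θ)) (W θ)

/-- The symplecticity error `E_sym` of the frame `P`, in terms of `Ω_{LL}`, `Ω_{LW}`, `A`, `B`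
and `C`. -/
def errSym (θ : Fin d → ℝ) :
    Matrix ((Fin d ⊕ Fin d) ⊕ (Fin m ⊕ Fin m)) ((Fin d ⊕ Fin d) ⊕ (Fin m ⊕ Fin m)) ℝ :=
  let A := matA S K W θ
  let B := matB S K θ
  let C := matC S K W θ
  let ΩLL := OmPair S K (matL K) (matL K) θ
  let ΩLW := OmPair S K (matL K) W θ
  Matrix.fromBlocks
    (Matrix.fromBlocks
      ΩLL                         (ΩLL * A + ΩLW * C)
      (Aᵀ * ΩLL - Cᵀ * ΩLWᵀ)      (Aᵀ * ΩLL * A + Bᵀ * ΩLL * B + Aᵀ * ΩLW * C - Cᵀ * ΩLWᵀ * A))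
    (Matrix.fromRows ΩLW (Aᵀ * ΩLW))
    (Matrix.fromCols (-ΩLWᵀ) (-(ΩLWᵀ * A)))
    0

/-- `K` is an analytic map of the torus into `U`, `W` is an analytic matrix map on the torus, and
the matrices `G_{LL}` and `Ω_{WW}`, whose inverses enter the definition of the frame, are
invertible. -/
structure IsFrameData : Prop where
  analytic_K : ∀ i, IsTorusAnalytic (fun θ => K θ i)
  analytic_W : ∀ i j, IsTorusAnalytic (fun θ => W θ i j)
  mapsTo : ∀ θ, K θ ∈ S.U
  invertible_GLL : ∀ θ, IsUnit (GPair S K (matL K) (matL K) θ)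
  invertible_OmWW : ∀ θ, IsUnit (OmPair S K W W θ)

/-- The quantities `L`, `W`, `B`, `Ω_{WW}⁻¹`, `Ω ∘ K`, `DΩ ∘ K` and `G ∘ K` have norm at most `M`
on the strip of width `ρ`. -/
structure BoundedBy (ρ : ℝ) (M : ℝ≥0) : Prop where
  L_le : stripNormMat ρ (matL K) ≤ M
  W_le : stripNormMat ρ W ≤ M
  B_le : stripNormMat ρ (matB S K) ≤ M
  OmWW_inv_le : stripNormMat ρ (fun θ => (OmPair S K W W θ)⁻¹) ≤ M
  Om_le : stripNormMat ρ (fun θ => S.Om (K θ)) ≤ M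
  DOm_le : ∀ k, stripNormMat ρ
    (fun θ => Matrix.of fun i j => pderiv k (fun z => S.Om z i j) (K θ)) ≤ M
  G_le : stripNormMat ρ (fun θ => S.G (K θ)) ≤ M

end Frame

end EllipticTorus

end

/-!
The first part is linear algebra: the compatibility relations give `Ω J = -G` and `G J = Ω`, and
with them the choice of `A`, `B` and `C` makes the pairings of `N` with `L`, `N` and `W` standard up
to terms in `Ω_{LL}` and `Ω_{LW}` (`frameP_symplectic`).

For the second part it is enough to bound `Ω_{LL}` and `Ω_{LW}` on the strip of width `ρ'`, since the
entries of `E_sym` are polynomials in these two matrices, linear in them, with coefficients built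
from `A`, `B` and `C`, which are bounded in terms of `M`. Differentiating the invariance equation
shows that `V = L` (with `Γ = 0` and error `D E_K`) and `V = W` (with `Γ = Γ_{α,β}` and error `E_W`)
solve the same linearised equation along the torus. Because the Hamiltonian flow preserves the
symplectic form, the terms without errors cancel, and (`dirDeriv_OmPair`)

`𝔏_ω Ω_{LV} - Ω_{LV} Γ = (D E_K)ᵀ Ω V + Lᵀ (D Ω [E_K]) V + Lᵀ Ω R`,

with `R` the error in the equation of `V`. In Fourier coefficients this equation has the divisors
`k · ω` for `V = L` and, in the variables that diagonalise the rotation part of `Γ`, divisors of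
modulus at least `|k · ω ∓ β_i|` for `V = W`, whatever `α` is. The Diophantine-Melnikov conditions
bound them from below. The only vanishing divisor is the one of `Ω_{LL}` at `k = 0`, and there the
coefficient of `Ω_{LL}` is zero since the symplectic form is exact (`rcoef_OmPair_LL_zero`).

All analytic estimates go through Fourier series. Translation into the complex strip gives
exponential decay of the coefficients of a function that is bounded on a strip
(`HasBound.norm_rcoef_le`), and conversely such a decay gives a holomorphic extension to any smaller
strip (`hasBound_of_norm_rcoef_le`). Multipliers of subexponential growth therefore only cost width
of the strip (`SubExp.exists_hasBound`); this gives both the Cauchy estimate for `D E_K` and the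
small divisor estimate. The differential identities are used at real arguments only, so that neither
the Hamiltonian nor the vector field has to be extended to the complex domain.
-/

namespace EllipticTorus

/-! ### Fourier coefficients on the torus -/

section

open MeasureTheory Filter Topology

variable {d : ℕ}

/-- The normalised Haar measure of `(ℝ/ℤ)^d`, with respect to which `UnitAddTorus.mFourierCoeff` is
defined. -/
noncomputable def torusMeasure (d : ℕ) : Measure (UnitAddTorus (Fin d)) :=
  Measure.pi fun _ => AddCircle.haarAddCircle

instance : IsProbabilityMeasure (torusMeasure d) := by
  unfold torusMeasure; infer_instance

instance : (torusMeasure d).IsAddHaarMeasure := by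
  unfold torusMeasure; infer_instance

/-- Periodicity in each variable, with period `p`. -/
def IsPeriodic {R X : Type*} [AddZeroClass R] (p : R) (f : (Fin d → R) → X) : Prop :=
  ∀ k, Function.Periodic f (Pi.single k p)

theorem IsPeriodic.add_int {X : Type*} {f : (Fin d → ℝ) → X} (hf : IsPeriodic (2 * Real.pi) f)
    (θ : Fin d → ℝ) (m : Fin d → ℤ) : f (θ + fun i => 2 * Real.pi * m i) = f θ := by
  have h : Function.Periodic f (∑ i, m i • (Pi.single i (2 * Real.pi) : Fin d → ℝ)) :=
    Finset.sum_induction _ (Function.Periodic f) (fun _ _ => Function.Periodic.add_period)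
      (by intro x; simp) (fun i _ => (hf i).zsmul (m i))
  convert h θ using 3
  ext i
  simp [Finset.sum_apply, Pi.single_apply, mul_comm]

/-- The function on `(ℝ/ℤ)^d` induced by a `2π`-periodic function on `ℝ^d`, by rescaling to period
`1` and choosing representatives in `[0, 1)`. -/
noncomputable def torusFun (f : (Fin d → ℝ) → ℂ) : UnitAddTorus (Fin d) → ℂ :=
  fun t => f fun i => 2 * Real.pi * (AddCircle.equivIco 1 0 (t i) : ℝ)

theorem torusFun_coe {f : (Fin d → ℝ) → ℂ} (hf : IsPeriodic (2 * Real.pi) f) (x : Fin d → ℝ) :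
    torusFun f (fun i => (x i : UnitAddCircle)) = f (fun i => 2 * Real.pi * x i) := by
  unfold torusFun
  simp only [AddCircle.coe_equivIco_mk_apply, div_one, mul_one]
  rw [← hf.add_int _ fun i => ⌊x i⌋]
  congr 1; ext i
  simp only [Pi.add_apply, ← mul_add, Int.fract_add_floor]

theorem continuous_torusFun {f : (Fin d → ℝ) → ℂ} (hf : IsPeriodic (2 * Real.pi) f)
    (hc : Continuous f) : Continuous (torusFun f) := by
  have hq : IsOpenQuotientMap (Pi.map fun (_ : Fin d) (x : ℝ) => (x : UnitAddCircle)) :=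
    .piMap fun _ => QuotientAddGroup.isOpenQuotientMap_mk
  rw [hq.isQuotientMap.continuous_iff]
  have : torusFun f ∘ (Pi.map fun (_ : Fin d) (x : ℝ) => (x : UnitAddCircle))
      = fun x => f (fun i => 2 * Real.pi * x i) := by
    ext x; exact torusFun_coe hf x
  rw [this]; fun_prop

/-- The Fourier coefficient of index `k` of a `2π`-periodic function. -/
noncomputable def coef (f : (Fin d → ℝ) → ℂ) (k : Fin d → ℤ) : ℂ :=
  UnitAddTorus.mFourierCoeff (torusFun f) k

theorem coef_eq_integral (f : (Fin d → ℝ) → ℂ) (k : Fin d → ℤ) :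
    coef f k = ∫ t, UnitAddTorus.mFourier (-k) t * torusFun f t ∂torusMeasure d := rfl

theorem norm_mFourier_apply (k : Fin d → ℤ) (t : UnitAddTorus (Fin d)) :
    ‖UnitAddTorus.mFourier k t‖ = 1 := by
  simp only [UnitAddTorus.mFourier, ContinuousMap.coe_mk, norm_prod, fourier_apply]
  exact Finset.prod_eq_one fun _ _ => Circle.norm_coe _

theorem mFourier_coe (k : Fin d → ℤ) (x : Fin d → ℝ) :
    UnitAddTorus.mFourier k (fun i => (x i : UnitAddCircle))
      = Complex.exp (2 * Real.pi * Complex.I * ∑ i, (k i : ℂ) * x i) := by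
  simp only [UnitAddTorus.mFourier, ContinuousMap.coe_mk, fourier_coe_apply, ← Complex.exp_sum]
  congr 1
  rw [Finset.mul_sum]
  refine Finset.sum_congr rfl fun i _ => ?_
  push_cast; ring

theorem norm_coef_le {f : (Fin d → ℝ) → ℂ} {b : ℝ} (hb : ∀ θ, ‖f θ‖ ≤ b) (k : Fin d → ℤ) :
    ‖coef f k‖ ≤ b := by
  rw [coef_eq_integral]
  refine (norm_integral_le_of_norm_le_const (C := b) (.of_forall fun t => ?_)).trans (by simp)
  rw [norm_mul, norm_mFourier_apply, one_mul]
  exact hb _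

theorem integrable_mFourier_mul {f : (Fin d → ℝ) → ℂ} (hf : IsPeriodic (2 * Real.pi) f)
    (hc : Continuous f) (k : Fin d → ℤ) :
    Integrable (fun t => UnitAddTorus.mFourier k t * torusFun f t) (torusMeasure d) :=
  ((UnitAddTorus.mFourier k).continuous.mul
    (continuous_torusFun hf hc)).integrable_of_hasCompactSupport (HasCompactSupport.of_compactSpace _)

theorem coef_add {f g : (Fin d → ℝ) → ℂ} (hf : IsPeriodic (2 * Real.pi) f) (hfc : Continuous f)
    (hg : IsPeriodic (2 * Real.pi) g) (hgc : Continuous g) (k : Fin d → ℤ) :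
    coef (fun θ => f θ + g θ) k = coef f k + coef g k := by
  simp only [coef_eq_integral]
  rw [← integral_add (integrable_mFourier_mul hf hfc _) (integrable_mFourier_mul hg hgc _)]
  refine integral_congr_ae (.of_forall fun t => ?_)
  simp only [torusFun]; ring

theorem coef_const_mul (c : ℂ) (f : (Fin d → ℝ) → ℂ) (k : Fin d → ℤ) :
    coef (fun θ => c * f θ) k = c * coef f k := by
  simp only [coef_eq_integral]
  rw [← integral_const_mul]
  refine integral_congr_ae (.of_forall fun t => ?_)
  simp only [torusFun]; ring

/-- A translation by `s` multiplies the coefficient of index `k` by `exp (i k · s)`. -/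
theorem coef_translate {f : (Fin d → ℝ) → ℂ} (hf : IsPeriodic (2 * Real.pi) f) (s : Fin d → ℝ)
    (k : Fin d → ℤ) :
    coef (fun θ => f (θ + s)) k = Complex.exp (Complex.I * ∑ i, (k i : ℂ) * s i) * coef f k := by
  have hp : (2 * Real.pi : ℝ) ≠ 0 := by positivity
  have hpc : (Real.pi : ℂ) ≠ 0 := by exact_mod_cast Real.pi_ne_zero
  set σ : UnitAddTorus (Fin d) := fun i => ((s i / (2 * Real.pi) : ℝ) : UnitAddCircle) with hσ
  have h1 : ∀ t, torusFun (fun θ => f (θ + s)) t = torusFun f (t + σ) := by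
    intro t
    obtain ⟨x, rfl⟩ : ∃ x : Fin d → ℝ, (fun i => (x i : UnitAddCircle)) = t := by
      refine ⟨fun i => (AddCircle.equivIco 1 0 (t i) : ℝ), ?_⟩
      ext i
      exact (AddCircle.equivIco 1 0).symm_apply_apply (t i)
    have h2 : IsPeriodic (2 * Real.pi) fun θ => f (θ + s) := fun i θ => by
      have := hf i (θ + s)
      simpa only [add_right_comm] using! this
    rw [torusFun_coe h2]
    have : (fun i => (x i : UnitAddCircle)) + σ
        = fun i => ((x i + s i / (2 * Real.pi) : ℝ) : UnitAddCircle) := by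
      ext i; simp [hσ]
    rw [this, torusFun_coe hf]
    congr 1; ext i
    simp only [Pi.add_apply]; field_simp
  have h2 : ∀ t, UnitAddTorus.mFourier (-k) t
      = UnitAddTorus.mFourier k σ * UnitAddTorus.mFourier (-k) (t + σ) := by
    intro t
    have h3 : UnitAddTorus.mFourier (-k) (t + σ)
        = UnitAddTorus.mFourier (-k) t * UnitAddTorus.mFourier (-k) σ := by
      simp only [UnitAddTorus.mFourier, ContinuousMap.coe_mk, Pi.add_apply, fourier_apply,
        smul_add, AddCircle.toCircle_add, Circle.coe_mul, Finset.prod_mul_distrib]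
    rw [h3, mul_left_comm, ← UnitAddTorus.mFourier_add, add_neg_cancel,
      UnitAddTorus.mFourier_zero]
    simp
  have h4 : UnitAddTorus.mFourier k σ = Complex.exp (Complex.I * ∑ i, (k i : ℂ) * s i) := by
    rw [hσ, mFourier_coe]
    congr 1
    rw [Finset.mul_sum, Finset.mul_sum]
    refine Finset.sum_congr rfl fun i _ => ?_
    push_cast; field_simp
  simp only [coef_eq_integral, h1]
  rw [← h4, ← integral_const_mul]
  rw [← integral_add_right_eq_self (fun t => UnitAddTorus.mFourier k σ
    * (UnitAddTorus.mFourier (-k) t * torusFun f t)) σ]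
  refine integral_congr_ae (.of_forall fun t => ?_)
  simp only [h2 t]; ring

/-- A continuous periodic function with summable coefficients is the sum of its Fourier series. -/
theorem hasSum_coef {f : (Fin d → ℝ) → ℂ} (hf : IsPeriodic (2 * Real.pi) f) (hc : Continuous f)
    (hs : Summable (coef f)) (θ : Fin d → ℝ) :
    HasSum (fun k => coef f k * Complex.exp (Complex.I * ∑ i, (k i : ℂ) * θ i)) (f θ) := by
  have hpc : (Real.pi : ℂ) ≠ 0 := by exact_mod_cast Real.pi_ne_zero
  have h := UnitAddTorus.hasSum_mFourier_series_apply_of_summable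
    (f := ⟨torusFun f, continuous_torusFun hf hc⟩) hs
    (fun i => ((θ i / (2 * Real.pi) : ℝ) : UnitAddCircle))
  simp only [ContinuousMap.coe_mk, torusFun_coe hf, mFourier_coe, smul_eq_mul] at h
  convert h using 1
  · ext k
    congr 2
    rw [Finset.mul_sum, Finset.mul_sum]
    refine Finset.sum_congr rfl fun i _ => ?_
    push_cast; field_simp
  · congr 1; ext i; field_simp

end

/-! ### Holomorphic extensions and decay of Fourier coefficients -/

section

open MeasureTheory Filter Topology

variable {d : ℕ}

theorem exists_norm_le_of_isPeriodic {f : (Fin d → ℝ) → ℂ} (hf : IsPeriodic (2 * Real.pi) f)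
    (hc : Continuous f) : ∃ b, ∀ θ, ‖f θ‖ ≤ b := by
  obtain ⟨b, hb⟩ := isCompact_univ.exists_bound_of_continuousOn
    (continuous_torusFun hf hc).continuousOn
  refine ⟨b, fun θ => ?_⟩
  have := hb (fun i => ((θ i / (2 * Real.pi) : ℝ) : UnitAddCircle)) (Set.mem_univ _)
  rw [torusFun_coe hf] at this
  have e : (fun i => 2 * Real.pi * (θ i / (2 * Real.pi))) = θ := by ext i; field_simp
  rwa [e] at this

theorem IsPeriodic.comp_add {f : (Fin d → ℝ) → ℂ} (hf : IsPeriodic (2 * Real.pi) f)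
    (s : Fin d → ℝ) : IsPeriodic (2 * Real.pi) fun θ => f (θ + s) := fun i θ => by
  simpa only [add_right_comm] using! hf i (θ + s)

/-- The directional derivative along `w` multiplies the coefficient of index `k` by `i k · w`. -/
theorem coef_deriv {f f' : (Fin d → ℝ) → ℂ} {w : Fin d → ℝ}
    (hf : IsPeriodic (2 * Real.pi) f) (hc : Continuous f)
    (hf' : IsPeriodic (2 * Real.pi) f') (hc' : Continuous f')
    (hd : ∀ θ, HasDerivAt (fun t : ℝ => f (θ + t • w)) (f' θ) 0) (k : Fin d → ℤ) :
    coef f' k = Complex.I * (∑ i, (k i : ℂ) * w i) * coef f k := by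
  obtain ⟨b, hb⟩ := exists_norm_le_of_isPeriodic hf' hc'
  have hd' : ∀ θ (t : ℝ), HasDerivAt (fun t : ℝ => f (θ + t • w)) (f' (θ + t • w)) t := by
    intro θ t
    have h := (hd (θ + t • w))
    have h2 : HasDerivAt (fun r : ℝ => r - t) 1 t := (hasDerivAt_id t).sub_const t
    have h3 := HasDerivAt.scomp_of_eq t h h2 (by simp)
    simp only [one_smul] at h3
    have e : (fun t : ℝ => f (θ + t • w)) = (fun r => f (θ + t • w + r • w)) ∘ fun r => r - t := by
      funext r
      simp only [Function.comp, add_assoc, ← add_smul, add_sub_cancel]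
    rwa [e]
  -- compute the derivative of the coefficient of the translate `f (· + t w)` at `t = 0` in two ways:
  -- under the integral sign, and from `coef_translate`
  have key := (hasDerivAt_integral_of_dominated_loc_of_deriv_le (μ := torusMeasure d)
    (F := fun t : ℝ => fun x => UnitAddTorus.mFourier (-k) x * torusFun (fun θ => f (θ + t • w)) x)
    (F' := fun t : ℝ => fun x =>
      UnitAddTorus.mFourier (-k) x * torusFun (fun θ => f' (θ + t • w)) x)
    (bound := fun _ => b) (x₀ := 0) (s := Set.univ) univ_mem
    (.of_forall fun t => (integrable_mFourier_mul (hf.comp_add _) (by fun_prop) _).1)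
    (integrable_mFourier_mul (hf.comp_add _) (by fun_prop) _)
    (integrable_mFourier_mul (hf'.comp_add _) (by fun_prop) _).1
    (.of_forall fun x t _ => by
      rw [norm_mul, norm_mFourier_apply, one_mul]; exact hb _)
    (integrable_const b)
    (.of_forall fun x t _ => (hd' _ t).const_mul _)).2
  simp only [← coef_eq_integral, coef_translate hf, zero_smul, add_zero] at key
  have h2 : HasDerivAt (fun t : ℝ => Complex.exp (Complex.I * ∑ i, (k i : ℂ) * ((t • w) i : ℝ))
      * coef f k) (Complex.I * (∑ i, (k i : ℂ) * w i) * coef f k) 0 := by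
    refine HasDerivAt.mul_const ?_ _
    have h3 : HasDerivAt (fun t : ℝ => (t : ℂ) * (Complex.I * ∑ i, (k i : ℂ) * w i))
        (1 * (Complex.I * ∑ i, (k i : ℂ) * w i)) 0 :=
      (Complex.ofRealCLM.hasDerivAt (x := (0 : ℝ))).mul_const _
    have h4 := h3.cexp
    simp only [Complex.ofReal_zero, zero_mul, Complex.exp_zero, one_mul] at h4
    have e : ∀ t : ℝ, Complex.I * ∑ i, (k i : ℂ) * ((t • w) i : ℝ)
        = t * (Complex.I * ∑ i, (k i : ℂ) * w i) := fun t => by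
      simp only [Finset.mul_sum]
      refine Finset.sum_congr rfl fun i _ => ?_
      simp only [Pi.smul_apply, smul_eq_mul]; push_cast; ring
    simpa only [e] using h4
  exact key.unique h2

/-- `∑ |k_l|`, the size of a multi-index. -/
noncomputable def absSum (k : Fin d → ℤ) : ℝ := ∑ l, |(k l : ℝ)|

theorem isOpen_strip (ρ : ℝ) : IsOpen (strip d ρ) := by
  simp only [strip, Set.ofPred_forall]
  exact isOpen_iInter_of_finite fun k => isOpen_lt (by fun_prop) continuous_const

theorem convex_strip (ρ : ℝ) : Convex ℝ (strip d ρ) := by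
  intro x hx y hy a b ha hb hab k
  have h1 := abs_lt.1 (hx k)
  have h2 := abs_lt.1 (hy k)
  simp only [Pi.add_apply, Pi.smul_apply, Complex.add_im, Complex.real_smul, Complex.mul_im,
    Complex.ofReal_re, Complex.ofReal_im, zero_mul, add_zero]
  rcases ha.eq_or_lt with rfl | ha'
  · obtain rfl : b = 1 := by linarith
    simpa using hy k
  · rw [abs_lt]; constructor <;> nlinarith

theorem strip_mono {ρ ρ' : ℝ} (h : ρ' ≤ ρ) : strip d ρ' ⊆ strip d ρ :=
  fun _ hx k => (hx k).trans_le h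

/-- A holomorphic function of one variable on a strip `|Im s| < r` that vanishes on `ℝ` vanishes. -/
theorem eq_zero_of_eq_zero_on_real {r : ℝ} (hr : 0 < r) {g : ℂ → ℂ}
    (hg : DifferentiableOn ℂ g {s | |s.im| < r}) (h0 : ∀ t : ℝ, g t = 0) {s : ℂ} (hs : |s.im| < r) :
    g s = 0 := by
  have hU : {s : ℂ | |s.im| < r} = Complex.im ⁻¹' (Set.Ioo (-r) r) := by
    ext s; simp [abs_lt]
  have ho : IsOpen {s : ℂ | |s.im| < r} := isOpen_lt (by fun_prop) continuous_const
  have hcv : Convex ℝ {s : ℂ | |s.im| < r} := by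
    rw [hU]; exact (convex_Ioo _ _).is_linear_preimage Complex.imLm.isLinear
  refine (hg.analyticOnNhd ho).eqOn_zero_of_preconnected_of_frequently_eq_zero
    hcv.isPreconnected (z₀ := 0) (by simpa using hr) ?_ hs
  have h1 : Tendsto (fun t : ℝ => (t : ℂ)) (𝓝[≠] 0) (𝓝[≠] 0) := by
    refine tendsto_nhdsWithin_of_tendsto_nhds_of_eventually_within _ ?_ ?_
    · exact (Complex.continuous_ofReal.tendsto' 0 0 (by simp)).mono_left nhdsWithin_le_nhds
    · filter_upwards [self_mem_nhdsWithin] with t ht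
      simpa using ht
  exact h1.frequently (Eventually.frequently (.of_forall h0))

/-- The complex line through the real point `x` with direction `y`. -/
def cline (x y : Fin d → ℝ) (s : ℂ) : Fin d → ℂ := fun i => x i + s * y i

theorem differentiable_cline (x y : Fin d → ℝ) : Differentiable ℂ (cline x y) := by
  unfold cline; fun_prop

theorem exists_cline_mem_strip {ρ : ℝ} {y : Fin d → ℝ} (hy : ∀ i, |y i| < ρ) :
    ∃ r > 1, ∀ (x : Fin d → ℝ) (s : ℂ), |s.im| < r → cline x y s ∈ strip d ρ := by
  have h : ∀ᶠ r : ℝ in 𝓝[>] 1, ∀ i, r * |y i| < ρ := by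
    rw [eventually_all]
    intro i
    refine (Continuous.tendsto' (by fun_prop) _ _ rfl).eventually_lt_const
      (by simpa using hy i) |>.filter_mono nhdsWithin_le_nhds
  obtain ⟨r, hr, hr1⟩ := (h.and self_mem_nhdsWithin).exists
  refine ⟨r, hr1, fun x s hs i => ?_⟩
  have : (cline x y s i).im = s.im * y i := by simp [cline]
  rw [this, abs_mul]
  exact (mul_le_mul_of_nonneg_right hs.le (abs_nonneg _)).trans_lt (hr i)

/-- The holomorphic extension of a periodic function is periodic. -/
theorem IsHolomorphicExtension.periodic {ρ : ℝ} {f : (Fin d → ℝ) → ℝ}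
    {F : (Fin d → ℂ) → ℂ} (hF : IsHolomorphicExtension ρ f F) (hf : IsPeriodic (2 * Real.pi) f)
    {z : Fin d → ℂ} (hz : z ∈ strip d ρ) (k : Fin d) :
    F (z + Pi.single k ((2 * Real.pi : ℝ) : ℂ)) = F z := by
  obtain ⟨hd, hr⟩ := hF
  set x : Fin d → ℝ := fun i => (z i).re with hx
  set y : Fin d → ℝ := fun i => (z i).im with hy
  -- both sides extend to the complex line `x + s y` through `z`, and agree for real `s`
  set x' : Fin d → ℝ := x + Pi.single k (2 * Real.pi) with hx'
  obtain ⟨r, hr1, hrs⟩ := exists_cline_mem_strip (ρ := ρ) (y := y) hz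
  have h1 : ∀ x : Fin d → ℝ, DifferentiableOn ℂ (fun s => F (cline x y s)) {s | |s.im| < r} :=
    fun x => hd.comp (differentiable_cline x y).differentiableOn fun s hs => hrs x s hs
  have hreal : ∀ (x : Fin d → ℝ) (t : ℝ), cline x y t = fun i => ((x + t • y) i : ℂ) := by
    intro x t; ext i; simp [cline]
  have h2 := eq_zero_of_eq_zero_on_real (by linarith) ((h1 x').sub (h1 x)) (s := Complex.I)
    (fun t => by
      simp only [Pi.sub_apply, hreal, hr]
      rw [hx', add_right_comm, hf k, sub_self]) (by simpa using hr1)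
  have e1 : cline x y Complex.I = z := by
    ext i; simp only [cline, hx, hy]; rw [mul_comm]; exact Complex.re_add_im _
  have e2 : cline x' y Complex.I = z + Pi.single k ((2 * Real.pi : ℝ) : ℂ) := by
    rw [← e1]; ext i
    by_cases h : i = k
    · subst h; simp [cline, hx']; ring
    · simp [cline, hx', h]
  simp only [Pi.sub_apply, e1, e2] at h2
  exact sub_eq_zero.1 h2

/-- Holomorphic dependence of the Fourier coefficients on a parameter. -/
theorem differentiableOn_coef {F : ℂ → (Fin d → ℝ) → ℂ} {U : Set ℂ} (hU : IsOpen U) {b : ℝ}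
    (hper : ∀ s ∈ U, IsPeriodic (2 * Real.pi) (F s)) (hcont : ∀ s ∈ U, Continuous (F s))
    (hdiff : ∀ θ, DifferentiableOn ℂ (fun s => F s θ) U) (hb : ∀ s ∈ U, ∀ θ, ‖F s θ‖ ≤ b)
    (k : Fin d → ℤ) : DifferentiableOn ℂ (fun s => coef (F s) k) U := by
  intro s₀ hs₀
  obtain ⟨ε, hε, hball⟩ := Metric.isOpen_iff.1 hU s₀ hs₀
  have hin : ∀ s ∈ Metric.ball s₀ (ε / 2), Metric.closedBall s (ε / 4) ⊆ U := fun s hs w hw =>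
    hball (by
      rw [Metric.mem_ball] at hs ⊢
      rw [Metric.mem_closedBall] at hw
      linarith [dist_triangle w s s₀])
  have hsU : ∀ s ∈ Metric.ball s₀ (ε / 2), s ∈ U := fun s hs =>
    hin s hs (Metric.mem_closedBall_self (by positivity))
  have hder : ∀ θ, ∀ s ∈ Metric.ball s₀ (ε / 2),
      HasDerivAt (fun s => F s θ) (deriv (fun s => F s θ) s) s := fun θ s hs =>
    ((hdiff θ).differentiableAt (hU.mem_nhds (hsU s hs))).hasDerivAt
  -- the Cauchy estimate on discs of radius `ε / 4` dominates the derivatives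
  have hder_le : ∀ θ, ∀ s ∈ Metric.ball s₀ (ε / 2),
      ‖deriv (fun s => F s θ) s‖ ≤ b / (ε / 4) := fun θ s hs =>
    Complex.norm_deriv_le_of_forall_mem_sphere_norm_le (by positivity)
      ((hdiff θ).mono (by
        rw [closure_ball _ (by positivity)]; exact hin s hs)).diffContOnCl
      fun w hw => hb w (hin s hs (Metric.sphere_subset_closedBall hw)) θ
  have hint : ∀ s ∈ U, Integrable (fun t => UnitAddTorus.mFourier (-k) t * torusFun (F s) t)
      (torusMeasure d) := fun s hs => integrable_mFourier_mul (hper s hs) (hcont s hs) _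
  have hnhds : Metric.ball s₀ (ε / 2) ∈ 𝓝 s₀ := Metric.ball_mem_nhds _ (by positivity)
  have hmeas : AEStronglyMeasurable (fun t => UnitAddTorus.mFourier (-k) t
      * torusFun (fun θ => deriv (fun s => F s θ) s₀) t) (torusMeasure d) := by
    refine (UnitAddTorus.mFourier (-k)).continuous.aestronglyMeasurable.mul ?_
    -- the derivative is a pointwise limit of difference quotients, which are continuous in `t`
    obtain ⟨u, hu⟩ := (𝓝[≠] s₀).exists_seq_tendsto
    obtain ⟨N, hN⟩ := eventually_atTop.1
      (hu.eventually (nhdsWithin_le_nhds (hU.mem_nhds hs₀)))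
    refine aestronglyMeasurable_of_tendsto_ae atTop
      (f := fun n t => torusFun (fun θ => slope (fun s => F s θ) s₀ (u (n + N))) t)
      (fun n => ?_) (.of_forall fun t => ?_)
    · simp only [torusFun, slope_def_field]
      exact (((continuous_torusFun (hper _ (hN _ (by omega))) (hcont _ (hN _ (by omega)))).sub
        (continuous_torusFun (hper _ hs₀) (hcont _ hs₀))).div_const _).aestronglyMeasurable
    · exact ((hder _ s₀ (Metric.mem_ball_self (by positivity))).tendsto_slope).comp
        (hu.comp (tendsto_add_atTop_nat N))
  exact (hasDerivAt_integral_of_dominated_loc_of_deriv_le (μ := torusMeasure d)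
    (F := fun s t => UnitAddTorus.mFourier (-k) t * torusFun (F s) t)
    (F' := fun s t => UnitAddTorus.mFourier (-k) t
      * torusFun (fun θ => deriv (fun s => F s θ) s) t)
    (bound := fun _ => b / (ε / 4)) hnhds
    (by filter_upwards [hU.mem_nhds hs₀] with s hs using (hint s hs).1)
    (hint _ hs₀) hmeas
    (.of_forall fun t s hs => by
      rw [norm_mul, norm_mFourier_apply, one_mul]; exact hder_le _ s hs)
    (integrable_const _)
    (.of_forall fun t s hs => (hder _ s hs).const_mul _)).2.differentiableAt.differentiableWithinAt

/-- A real function on `ℝ^d` has a holomorphic extension of modulus at most `b` on the strip of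
width `ρ`. -/
def HasBound (ρ : ℝ) (f : (Fin d → ℝ) → ℝ) (b : ℝ) : Prop :=
  ∃ F, IsHolomorphicExtension ρ f F ∧ ∀ z ∈ strip d ρ, ‖F z‖ ≤ b

/-- The Fourier coefficients of a real function. -/
noncomputable abbrev rcoef (f : (Fin d → ℝ) → ℝ) (k : Fin d → ℤ) : ℂ := coef (fun θ => (f θ : ℂ)) k

/-- Exponential decay of the Fourier coefficients, by translation into the complex strip. -/
theorem HasBound.norm_rcoef_le {ρ r b : ℝ} (hr0 : 0 ≤ r) (hr : r < ρ) {f : (Fin d → ℝ) → ℝ}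
    (hb : HasBound ρ f b) (hf : IsPeriodic (2 * Real.pi) f) (k : Fin d → ℤ) :
    ‖rcoef f k‖ ≤ b * Real.exp (-(r * absSum k)) := by
  obtain ⟨F, hF, hFb⟩ := hb
  -- the imaginary translation `i y` multiplies the coefficient by `exp (- k · y)`
  set y : Fin d → ℝ := fun i => -(r * SignType.sign (k i : ℝ)) with hy
  have hyρ : ∀ i, |y i| < ρ := fun i => by
    rw [hy]
    simp only [abs_neg, abs_mul, abs_of_nonneg hr0]
    refine (mul_le_of_le_one_right hr0 ?_).trans_lt hr
    rcases lt_trichotomy (k i : ℝ) 0 with h | h | h <;> simp [h, sign_neg, sign_pos]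
  obtain ⟨R, hR1, hR⟩ := exists_cline_mem_strip hyρ
  have hdist : ∀ (x : Fin d → ℝ) (i : Fin d) (s : ℂ), cline (x + Pi.single i (2 * Real.pi)) y s
      = cline x y s + Pi.single i ((2 * Real.pi : ℝ) : ℂ) := by
    intro x i s; ext j
    by_cases h : j = i
    · subst h; simp [cline]; ring
    · simp [cline, h]
  have hΦ : DifferentiableOn ℂ (fun s => coef (fun θ => F (cline θ y s)) k) {s | |s.im| < R} := by
    refine differentiableOn_coef (b := b) (U := {s | |s.im| < R})
      (isOpen_lt (by fun_prop) continuous_const)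
      (fun s hs i θ => ?_) (fun s hs => ?_) (fun θ => ?_) (fun s hs θ => hFb _ (hR θ s hs)) k
    · rw [hdist]
      exact hF.periodic hf (hR θ s hs) i
    · exact hF.1.continuousOn.comp_continuous (by unfold cline; fun_prop) fun θ => hR θ s hs
    · exact hF.1.comp (differentiable_cline θ y).differentiableOn fun s hs => hR θ s hs
  have hfc : IsPeriodic (2 * Real.pi) fun θ => (f θ : ℂ) := fun i θ => by
    exact congrArg _ (hf i θ)
  have hreal : ∀ t : ℝ, coef (fun θ => F (cline θ y t)) k
      = Complex.exp (t * (Complex.I * ∑ i, (k i : ℂ) * y i)) * rcoef f k := by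
    intro t
    have e : ∀ θ, F (cline θ y t) = (f (θ + t • y) : ℂ) := fun θ => by
      rw [← hF.2]; congr 1; ext i; simp [cline]
    simp only [e]
    rw [coef_translate hfc]
    congr 2
    simp only [Finset.mul_sum]
    refine Finset.sum_congr rfl fun i _ => ?_
    simp only [Pi.smul_apply, smul_eq_mul]; push_cast; ring
  have hI := eq_zero_of_eq_zero_on_real (by linarith)
    (hΦ.sub (g := fun s => Complex.exp (s * (Complex.I * ∑ i, (k i : ℂ) * y i)) * rcoef f k)
      (by fun_prop)) (s := Complex.I)
    (fun t => by simp only [Pi.sub_apply, hreal, sub_self]) (by simpa using hR1)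
  simp only [Pi.sub_apply, sub_eq_zero] at hI
  have e : Complex.I * (Complex.I * ∑ i, (k i : ℂ) * y i) = ((r * absSum k : ℝ) : ℂ) := by
    rw [← mul_assoc, Complex.I_mul_I, absSum, Finset.mul_sum, Finset.mul_sum]
    push_cast
    refine Finset.sum_congr rfl fun i _ => ?_
    rw [← sign_mul_self (k i : ℝ), hy]
    push_cast; ring
  have hle : ‖coef (fun θ => F (cline θ y Complex.I)) k‖ ≤ b :=
    norm_coef_le (fun θ => hFb _ (hR θ _ (by simpa using hR1))) k
  rw [hI, e, norm_mul, Complex.norm_exp, Complex.ofReal_re] at hle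
  rw [Real.exp_neg, ← div_eq_mul_inv, le_div_iff₀ (Real.exp_pos _), mul_comm]
  exact hle

end

/-! ### Fourier series on complex strips -/

section

open MeasureTheory Filter Topology

variable {d : ℕ}

theorem absSum_nonneg (k : Fin d → ℤ) : 0 ≤ absSum k :=
  Finset.sum_nonneg fun _ _ => abs_nonneg _

theorem one_le_absSum {k : Fin d → ℤ} (hk : k ≠ 0) : 1 ≤ absSum k := by
  obtain ⟨i, hi⟩ := Function.ne_iff.1 hk
  have h1 : (1 : ℝ) ≤ |(k i : ℝ)| := by exact_mod_cast Int.one_le_abs hi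
  exact h1.trans (Finset.single_le_sum (f := fun l => |(k l : ℝ)|)
    (fun _ _ => abs_nonneg _) (Finset.mem_univ i))

theorem summable_exp_neg_mul_abs_int {δ : ℝ} (hδ : 0 < δ) :
    Summable fun k : ℤ => Real.exp (-(δ * |(k : ℝ)|)) := by
  have h : Summable fun n : ℕ => Real.exp (-(δ * n)) := by
    have := Real.summable_exp_nat_mul_iff.2 (neg_lt_zero.2 hδ)
    refine this.congr fun n => ?_
    congr 1; ring
  refine Summable.of_nat_of_neg ?_ ?_ <;> simpa using h

theorem summable_exp_neg_absSum {δ : ℝ} (hδ : 0 < δ) :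
    ∀ d : ℕ, Summable fun k : Fin d → ℤ => Real.exp (-(δ * absSum k))
  | 0 => (hasSum_fintype _).summable
  | d + 1 => by
    rw [← (Fin.consEquiv fun _ : Fin (d + 1) => ℤ).summable_iff]
    have h := (summable_exp_neg_mul_abs_int hδ).mul_of_nonneg (summable_exp_neg_absSum hδ d)
      (fun _ => (Real.exp_pos _).le) (fun _ => (Real.exp_pos _).le)
    refine h.congr fun p => ?_
    rw [← Real.exp_add]
    congr 1
    simp [absSum, Fin.consEquiv, Fin.sum_univ_succ]
    ring

/-- The value `∑ exp (-δ |k|)` that bounds a Fourier series with coefficients of this size. -/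
noncomputable def expSum (d : ℕ) (δ : ℝ) : ℝ := ∑' k : Fin d → ℤ, Real.exp (-(δ * absSum k))

theorem expSum_nonneg (d : ℕ) (δ : ℝ) : 0 ≤ expSum d δ := tsum_nonneg fun _ => (Real.exp_pos _).le

/-- The exponential monomial `exp (i k · z)`, in complex variables. -/
noncomputable def expMonomial (k : Fin d → ℤ) (z : Fin d → ℂ) : ℂ :=
  Complex.exp (Complex.I * ∑ i, (k i : ℂ) * z i)

theorem norm_expMonomial_le {r : ℝ} {z : Fin d → ℂ} (hz : z ∈ strip d r) (k : Fin d → ℤ) :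
    ‖expMonomial k z‖ ≤ Real.exp (r * absSum k) := by
  rw [expMonomial, Complex.norm_exp]
  refine Real.exp_le_exp.2 ?_
  rw [Complex.I_mul_re, Complex.im_sum, absSum, Finset.mul_sum, ← Finset.sum_neg_distrib]
  simp only [Complex.mul_im, Complex.intCast_re, Complex.intCast_im, zero_mul, add_zero]
  refine Finset.sum_le_sum fun i _ => ?_
  calc -((k i : ℝ) * (z i).im) ≤ |(k i : ℝ) * (z i).im| := neg_le_abs _
    _ = |(k i : ℝ)| * |(z i).im| := abs_mul _ _
    _ ≤ r * |(k i : ℝ)| := by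
      rw [mul_comm]; exact mul_le_mul_of_nonneg_right (hz i).le (abs_nonneg _)

theorem hasFDerivAt_expMonomial (k : Fin d → ℤ) (z : Fin d → ℂ) :
    HasFDerivAt (expMonomial k) (expMonomial k z • Complex.I • ∑ i, (k i : ℂ) •
      (ContinuousLinearMap.proj (R := ℂ) (φ := fun _ : Fin d => ℂ) i)) z := by
  have h : HasFDerivAt (fun z : Fin d → ℂ => Complex.I * ∑ i, (k i : ℂ) * z i)
      (Complex.I • ∑ i, (k i : ℂ) • (ContinuousLinearMap.proj (R := ℂ)
        (φ := fun _ : Fin d => ℂ) i)) z := by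
    refine HasFDerivAt.const_mul ?_ _
    refine HasFDerivAt.fun_sum fun i _ => ?_
    exact (ContinuousLinearMap.hasFDerivAt (ContinuousLinearMap.proj (R := ℂ)
      (φ := fun _ : Fin d => ℂ) i)).const_mul _
  exact h.cexp

theorem norm_fderiv_expMonomial_le {r : ℝ} {z : Fin d → ℂ} (hz : z ∈ strip d r) (k : Fin d → ℤ) :
    ‖expMonomial k z • Complex.I • ∑ i, (k i : ℂ) •
      (ContinuousLinearMap.proj (R := ℂ) (φ := fun _ : Fin d => ℂ) i)‖
        ≤ Real.exp (r * absSum k) * absSum k := by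
  rw [norm_smul, norm_smul, Complex.norm_I, one_mul]
  refine mul_le_mul (norm_expMonomial_le hz k) ?_ (norm_nonneg _) (Real.exp_pos _).le
  refine (norm_sum_le _ _).trans (Finset.sum_le_sum fun i _ => ?_)
  rw [norm_smul]
  refine (mul_le_of_le_one_right (norm_nonneg _)
    (ContinuousLinearMap.opNorm_le_bound _ zero_le_one fun x => ?_)).trans_eq (by simp)
  rw [one_mul]; exact norm_le_pi_norm x i

/-- A function whose Fourier coefficients decay like `exp (-r |k|)` extends to every strip of
width `r' < r`. -/
theorem hasBound_of_norm_rcoef_le {r r' C : ℝ} (hr' : 0 < r') (hr : r' < r)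
    {f : (Fin d → ℝ) → ℝ} (hf : IsPeriodic (2 * Real.pi) f) (hc : Continuous f)
    (h : ∀ k, ‖rcoef f k‖ ≤ C * Real.exp (-(r * absSum k))) :
    HasBound r' f (C * expSum d (r - r')) := by
  have hC : 0 ≤ C := by
    have := (norm_nonneg _).trans (h 0)
    exact nonneg_of_mul_nonneg_left this (Real.exp_pos _)
  have hfc : IsPeriodic (2 * Real.pi) fun θ => (f θ : ℂ) := fun i θ => congrArg _ (hf i θ)
  have hexp : ∀ k : Fin d → ℤ, C * Real.exp (-(r * absSum k)) * Real.exp (r' * absSum k)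
      = C * Real.exp (-((r - r') * absSum k)) := fun k => by
    rw [mul_assoc, ← Real.exp_add]; congr 2; ring
  have hsum1 := (summable_exp_neg_absSum (sub_pos.2 hr) d).mul_left C
  have hterm : ∀ k, ∀ z ∈ strip d r', ‖rcoef f k * expMonomial k z‖
      ≤ C * Real.exp (-((r - r') * absSum k)) := fun k z hz => by
    rw [norm_mul, ← hexp]
    exact mul_le_mul (h k) (norm_expMonomial_le hz k) (norm_nonneg _)
      (mul_nonneg hC (Real.exp_pos _).le)
  have hsum : ∀ z ∈ strip d r', Summable fun k => rcoef f k * expMonomial k z := fun z hz =>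
    .of_norm_bounded hsum1 fun k => hterm k z hz
  refine ⟨fun z => ∑' k, rcoef f k * expMonomial k z, ⟨?_, fun x => ?_⟩, fun z hz => ?_⟩
  · -- half of the exponential decay absorbs the factor `|k|` of the derivative
    set η := (r - r') / 2 with hη
    have hη0 : 0 < η := by rw [hη]; linarith
    have hu := (summable_exp_neg_absSum hη0 d).mul_left (C / η)
    intro z hz
    refine (hasFDerivAt_tsum_of_isPreconnected hu (isOpen_strip r') (convex_strip r').isPreconnected
      (fun k z _ => (hasFDerivAt_expMonomial k z).const_mul (rcoef f k)) (fun k z hz => ?_)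
      hz (hsum z hz) hz).differentiableAt.differentiableWithinAt
    rw [norm_smul]
    have h1 : η * absSum k ≤ Real.exp (η * absSum k) :=
      (by linarith : η * absSum k ≤ η * absSum k + 1).trans (Real.add_one_le_exp _)
    have hab := absSum_nonneg k
    calc ‖rcoef f k‖ * _ ≤ (C * Real.exp (-(r * absSum k)))
          * (Real.exp (r' * absSum k) * absSum k) :=
          mul_le_mul (h k) (norm_fderiv_expMonomial_le hz k) (norm_nonneg _)
            (mul_nonneg hC (Real.exp_pos _).le)
      _ = C / η * Real.exp (-((r - r') * absSum k)) * (η * absSum k) := by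
          rw [← mul_assoc, hexp]; field_simp
      _ ≤ C / η * Real.exp (-((r - r') * absSum k)) * Real.exp (η * absSum k) := by
          gcongr
      _ = C / η * Real.exp (-(η * absSum k)) := by
          rw [mul_assoc, ← Real.exp_add]; congr 2; rw [hη]; ring
  · refine (hasSum_coef hfc (by fun_prop) ?_ x).tsum_eq
    refine .of_norm_bounded hsum1 fun k => (h k).trans ?_
    rw [← hexp]
    exact le_mul_of_one_le_right (mul_nonneg hC (Real.exp_pos _).le)
      (Real.one_le_exp (mul_nonneg hr'.le (absSum_nonneg k)))
  · rw [expSum, ← tsum_mul_left]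
    exact tsum_of_norm_bounded hsum1.hasSum fun k => hterm k z hz

/-- A multiplier of subexponential growth: `D k` is `O(exp (δ |k|))` for every `δ > 0`. -/
def SubExp (D : (Fin d → ℤ) → ℝ) : Prop :=
  ∀ δ > 0, ∃ C ≥ 0, ∀ k, D k ≤ C * Real.exp (δ * absSum k)

/-- Functions whose Fourier coefficients are dominated by those of two bounded functions, up to
subexponential factors, are bounded on smaller strips. This covers both the Cauchy estimates and
the small divisor estimates. -/
theorem SubExp.exists_hasBound {D : (Fin d → ℤ) → ℝ} (hD : SubExp D) {ρ ρ' : ℝ} (hρ' : 0 < ρ')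
    (hρ : ρ' < ρ) : ∃ c ≥ 0, ∀ (f g₁ g₂ : (Fin d → ℝ) → ℝ) (b : ℝ),
      IsPeriodic (2 * Real.pi) f → Continuous f → IsPeriodic (2 * Real.pi) g₁ →
      IsPeriodic (2 * Real.pi) g₂ → HasBound ρ g₁ b → HasBound ρ g₂ b →
      (∀ k, ‖rcoef f k‖ ≤ D k * (‖rcoef g₁ k‖ + ‖rcoef g₂ k‖)) → HasBound ρ' f (c * b) := by
  set δ := (ρ - ρ') / 3 with hδ
  have hδ0 : 0 < δ := by rw [hδ]; linarith
  obtain ⟨C, hC, hDC⟩ := hD δ hδ0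
  refine ⟨2 * C * expSum d δ, by have := expSum_nonneg d δ; positivity, ?_⟩
  intro f g₁ g₂ b hf hfc hg₁ hg₂ hb₁ hb₂ h
  have h1 : HasBound ρ' f (2 * C * b * expSum d (ρ' + δ - ρ')) := by
    refine hasBound_of_norm_rcoef_le hρ' (by linarith) hf hfc fun k => (h k).trans ?_
    have e1 := hb₁.norm_rcoef_le (r := ρ' + 2 * δ) (by linarith) (by rw [hδ]; linarith) hg₁ k
    have e2 := hb₂.norm_rcoef_le (r := ρ' + 2 * δ) (by linarith) (by rw [hδ]; linarith) hg₂ k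
    calc D k * (‖rcoef g₁ k‖ + ‖rcoef g₂ k‖)
        ≤ (C * Real.exp (δ * absSum k)) * (‖rcoef g₁ k‖ + ‖rcoef g₂ k‖) :=
          mul_le_mul_of_nonneg_right (hDC k) (by positivity)
      _ ≤ (C * Real.exp (δ * absSum k)) * (b * Real.exp (-((ρ' + 2 * δ) * absSum k))
            + b * Real.exp (-((ρ' + 2 * δ) * absSum k))) := by gcongr
      _ = 2 * C * b * (Real.exp (δ * absSum k) * Real.exp (-((ρ' + 2 * δ) * absSum k))) := by ring
      _ = 2 * C * b * Real.exp (-((ρ' + δ) * absSum k)) := by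
          rw [← Real.exp_add]; congr 2; ring
  rw [add_sub_cancel_left] at h1
  convert h1 using 1; ring

end

/-! ### Bounds on strips -/

section

variable {d : ℕ}

section Bounds

variable {ρ a b : ℝ} {f g : (Fin d → ℝ) → ℝ}

theorem HasBound.mono (hf : HasBound ρ f a) (h : a ≤ b) : HasBound ρ f b := by
  obtain ⟨F, hF, hb⟩ := hf
  exact ⟨F, hF, fun z hz => (hb z hz).trans h⟩

theorem HasBound.restrict {ρ' : ℝ} (hf : HasBound ρ f a) (h : ρ' ≤ ρ) : HasBound ρ' f a := by
  obtain ⟨F, hF, hb⟩ := hf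
  exact ⟨F, ⟨hF.1.mono (strip_mono h), hF.2⟩, fun z hz => hb z (strip_mono h hz)⟩

theorem hasBound_zero : HasBound ρ (fun _ : Fin d → ℝ => 0) 0 :=
  ⟨fun _ => 0, ⟨differentiableOn_const _, fun _ => by simp⟩, fun _ _ => by simp⟩

theorem HasBound.add (hf : HasBound ρ f a) (hg : HasBound ρ g b) :
    HasBound ρ (fun θ => f θ + g θ) (a + b) := by
  obtain ⟨F, hF, hFb⟩ := hf
  obtain ⟨G, hG, hGb⟩ := hg
  exact ⟨fun z => F z + G z, ⟨hF.1.add hG.1, fun x => by simp [hF.2, hG.2]⟩,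
    fun z hz => (norm_add_le _ _).trans (add_le_add (hFb z hz) (hGb z hz))⟩

theorem HasBound.mul (hf : HasBound ρ f a) (hg : HasBound ρ g b) :
    HasBound ρ (fun θ => f θ * g θ) (a * b) := by
  obtain ⟨F, hF, hFb⟩ := hf
  obtain ⟨G, hG, hGb⟩ := hg
  refine ⟨fun z => F z * G z, ⟨hF.1.mul hG.1, fun x => by simp [hF.2, hG.2]⟩, fun z hz => ?_⟩
  rw [norm_mul]
  exact mul_le_mul (hFb z hz) (hGb z hz) (norm_nonneg _) ((norm_nonneg _).trans (hFb z hz))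

theorem HasBound.const_mul (hf : HasBound ρ f a) (c : ℝ) :
    HasBound ρ (fun θ => c * f θ) (|c| * a) := by
  obtain ⟨F, hF, hFb⟩ := hf
  refine ⟨fun z => c * F z, ⟨hF.1.const_mul _, fun x => by simp [hF.2]⟩, fun z hz => ?_⟩
  rw [norm_mul, Complex.norm_real]
  exact mul_le_mul_of_nonneg_left (hFb z hz) (abs_nonneg _)

theorem HasBound.neg (hf : HasBound ρ f a) : HasBound ρ (fun θ => -f θ) a := by
  simpa using hf.const_mul (-1)

theorem HasBound.sum {ι : Type*} (s : Finset ι) {f : ι → (Fin d → ℝ) → ℝ}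
    (hf : ∀ i, HasBound ρ (f i) a) : HasBound ρ (fun θ => ∑ i ∈ s, f i θ) (s.card * a) := by
  classical
  induction s using Finset.induction_on with
  | empty => simpa using hasBound_zero
  | insert i s hi ih =>
    simp only [Finset.sum_insert hi, Finset.card_insert_of_notMem hi]
    convert (hf i).add ih using 1
    push_cast; ring

theorem HasBound.nonneg (hρ : 0 < ρ) (hf : HasBound ρ f a) : 0 ≤ a := by
  obtain ⟨F, -, hb⟩ := hf
  exact (norm_nonneg _).trans (hb 0 fun k => by simpa using hρ)

theorem HasBound.stripNorm_le (hf : HasBound ρ f a) : stripNorm ρ f ≤ ENNReal.ofReal a := by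
  obtain ⟨F, hF, hb⟩ := hf
  refine iInf₂_le_of_le F hF (iSup₂_le fun z hz => ?_)
  rw [← ofReal_norm]
  exact ENNReal.ofReal_le_ofReal (hb z hz)

/-- The strict inequality selects an extension, without appeal to its uniqueness. -/
theorem hasBound_of_stripNorm_lt {b : ℝ≥0} (h : stripNorm ρ f < b) : HasBound ρ f b := by
  obtain ⟨F, hF⟩ := iInf_lt_iff.1 h
  obtain ⟨hF, hb⟩ := iInf_lt_iff.1 hF
  refine ⟨F, hF, fun z hz => ?_⟩
  have := (le_iSup₂ (f := fun z (_ : z ∈ strip d ρ) => ‖F z‖ₑ) z hz).trans hb.le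
  rw [enorm_le_coe] at this
  exact_mod_cast this

end Bounds

/-- All entries of a matrix function are bounded by `b` on the strip of width `ρ`. -/
def MatBound {p q : Type*} (ρ : ℝ) (A : (Fin d → ℝ) → Matrix p q ℝ) (b : ℝ) : Prop :=
  ∀ i j, HasBound ρ (fun θ => A θ i j) b

section MatBounds

variable {p q r : Type*} {ρ a b : ℝ} {A A' : (Fin d → ℝ) → Matrix p q ℝ}
  {B : (Fin d → ℝ) → Matrix q r ℝ}

theorem MatBound.mono (hA : MatBound ρ A a) (h : a ≤ b) : MatBound ρ A b :=
  fun i j => (hA i j).mono h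

theorem MatBound.restrict {ρ' : ℝ} (hA : MatBound ρ A a) (h : ρ' ≤ ρ) : MatBound ρ' A a :=
  fun i j => (hA i j).restrict h

theorem MatBound.transpose (hA : MatBound ρ A a) : MatBound ρ (fun θ => (A θ)ᵀ) a :=
  fun i j => hA j i

theorem MatBound.add (hA : MatBound ρ A a) (hA' : MatBound ρ A' b) :
    MatBound ρ (fun θ => A θ + A' θ) (a + b) := fun i j => (hA i j).add (hA' i j)

theorem MatBound.neg (hA : MatBound ρ A a) : MatBound ρ (fun θ => -A θ) a :=
  fun i j => (hA i j).neg

theorem MatBound.sub (hA : MatBound ρ A a) (hA' : MatBound ρ A' b) :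
    MatBound ρ (fun θ => A θ - A' θ) (a + b) := by
  simpa only [sub_eq_add_neg] using hA.add hA'.neg

theorem MatBound.smul (hA : MatBound ρ A a) (c : ℝ) : MatBound ρ (fun θ => c • A θ) (|c| * a) :=
  fun i j => (hA i j).const_mul c

theorem MatBound.mul [Fintype q] (hA : MatBound ρ A a) (hB : MatBound ρ B b) :
    MatBound ρ (fun θ => A θ * B θ) (Fintype.card q * (a * b)) := fun i j =>
  HasBound.sum Finset.univ fun l => (hA i l).mul (hB l j)

theorem MatBound.stripNormMat_le (hA : MatBound ρ A a) :
    stripNormMat ρ A ≤ ENNReal.ofReal a :=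
  iSup₂_le fun i j => (hA i j).stripNorm_le

theorem matBound_of_stripNormMat_lt {b : ℝ≥0} (h : stripNormMat ρ A < b) : MatBound ρ A b :=
  fun i j => hasBound_of_stripNorm_lt
    ((le_iSup₂ (f := fun i j => stripNorm ρ fun θ => A θ i j) i j).trans_lt h)

end MatBounds

/-! ### Small divisors -/

theorem subExp_rpow_absSum (τ : ℝ) : SubExp fun k : Fin d → ℤ => absSum k ^ τ := by
  intro δ hδ
  set N := ⌈τ⌉₊
  refine ⟨N.factorial / δ ^ N + 1, by positivity, fun k => ?_⟩
  have h0 := absSum_nonneg k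
  have h1 : absSum k ^ τ ≤ absSum k ^ N + 1 := by
    by_cases hk : k = 0
    · have : absSum k = 0 := by simp [hk, absSum]
      rw [this]
      exact (Real.zero_rpow_le_one τ).trans (le_add_of_nonneg_left (by positivity))
    · rw [← Real.rpow_natCast]
      exact (Real.rpow_le_rpow_of_exponent_le (one_le_absSum hk) (Nat.le_ceil τ)).trans
        (le_add_of_nonneg_right zero_le_one)
  have h2 := Real.pow_div_factorial_le_exp (δ * absSum k) (by positivity) N
  have h3 : (1 : ℝ) ≤ Real.exp (δ * absSum k) := Real.one_le_exp (by positivity)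
  have h4 : absSum k ^ N = N.factorial / δ ^ N * ((δ * absSum k) ^ N / N.factorial) := by
    rw [mul_pow]; field_simp
  calc absSum k ^ τ ≤ absSum k ^ N + 1 := h1
    _ ≤ N.factorial / δ ^ N * Real.exp (δ * absSum k) + Real.exp (δ * absSum k) := by
      rw [h4]; gcongr
    _ = _ := by ring

theorem SubExp.mul_const_add {D : (Fin d → ℤ) → ℝ} (hD : SubExp D) {a b : ℝ} (ha : 0 ≤ a)
    (hb : 0 ≤ b) : SubExp fun k => D k * a + b := by
  intro δ hδ
  obtain ⟨C, hC, h⟩ := hD δ hδ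
  refine ⟨C * a + b, by positivity, fun k => ?_⟩
  have h3 : (1 : ℝ) ≤ Real.exp (δ * absSum k) :=
    Real.one_le_exp (mul_nonneg hδ.le (absSum_nonneg k))
  nlinarith [mul_le_mul_of_nonneg_right (h k) ha, mul_le_mul_of_nonneg_left h3 hb]

/-- The reciprocal of the lower bound on the small divisors; the last term accounts for `k = 0`. -/
noncomputable def divisorBound {m : ℕ} (β : Fin m → ℝ) (γ τ : ℝ) (k : Fin d → ℤ) : ℝ :=
  absSum k ^ τ * γ⁻¹ + ∑ i, |β i|⁻¹

section Divisors

variable {m : ℕ} {ω : Fin d → ℝ} {β : Fin m → ℝ} {γ τ : ℝ}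

theorem DiophantineMelnikov.subExp_divisorBound (h : DiophantineMelnikov ω β γ τ) :
    SubExp (divisorBound (d := d) β γ τ) :=
  (subExp_rpow_absSum τ).mul_const_add (inv_nonneg.2 h.γ_pos.le)
    (Finset.sum_nonneg fun _ _ => inv_nonneg.2 (abs_nonneg _))

theorem DiophantineMelnikov.one_le_of_le (h : DiophantineMelnikov ω β γ τ) {k : Fin d → ℤ}
    (hk : k ≠ 0) {x : ℝ} (hx : γ / absSum k ^ τ ≤ x) : 1 ≤ divisorBound β γ τ k * x := by
  have h1 : 0 < absSum k ^ τ := Real.rpow_pos_of_pos (zero_lt_one.trans_le (one_le_absSum hk)) _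
  have hγ := h.γ_pos
  have hx0 : 0 < x := (div_pos hγ h1).trans_le hx
  have h2 : 0 ≤ ∑ i, |β i|⁻¹ := Finset.sum_nonneg fun _ _ => inv_nonneg.2 (abs_nonneg _)
  calc (1 : ℝ) = absSum k ^ τ * γ⁻¹ * (γ / absSum k ^ τ) := by field_simp
    _ ≤ absSum k ^ τ * γ⁻¹ * x := by gcongr
    _ ≤ divisorBound β γ τ k * x := by
      rw [divisorBound, add_mul]
      exact le_add_of_nonneg_right (mul_nonneg h2 hx0.le)

theorem DiophantineMelnikov.one_le_mul_freq (h : DiophantineMelnikov ω β γ τ) {k : Fin d → ℤ}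
    (hk : k ≠ 0) : 1 ≤ divisorBound β γ τ k * |∑ l, (k l : ℝ) * ω l| :=
  h.one_le_of_le hk (h.diophantine k hk)

theorem DiophantineMelnikov.one_le_mul_freq_sub (h : DiophantineMelnikov ω β γ τ) (k : Fin d → ℤ)
    (i : Fin m) : 1 ≤ divisorBound β γ τ k * |(∑ l, (k l : ℝ) * ω l) - β i| := by
  by_cases hk : k = 0
  · have hβ : 0 < |β i| := abs_pos.2 (h.β_ne_zero i)
    have h1 : |β i|⁻¹ ≤ divisorBound β γ τ k := by
      refine (Finset.single_le_sum (f := fun i => |β i|⁻¹)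
        (fun _ _ => inv_nonneg.2 (abs_nonneg _)) (Finset.mem_univ i)).trans
        (le_add_of_nonneg_left ?_)
      exact mul_nonneg (Real.rpow_nonneg (absSum_nonneg k) _) (inv_nonneg.2 h.γ_pos.le)
    have h2 : |(∑ l, (k l : ℝ) * ω l) - β i| = |β i| := by simp [hk]
    rw [h2]
    calc (1 : ℝ) = |β i|⁻¹ * |β i| := by field_simp
      _ ≤ _ := by gcongr
  · exact h.one_le_of_le hk (h.melnikov_one k hk i)

theorem DiophantineMelnikov.one_le_mul_freq_add (h : DiophantineMelnikov ω β γ τ) (k : Fin d → ℤ)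
    (i : Fin m) : 1 ≤ divisorBound β γ τ k * |(∑ l, (k l : ℝ) * ω l) + β i| := by
  have := h.one_le_mul_freq_sub (-k) i
  have e1 : absSum (-k) = absSum k := by simp [absSum]
  have e2 : |(∑ l, ((-k) l : ℝ) * ω l) - β i| = |(∑ l, (k l : ℝ) * ω l) + β i| := by
    rw [← abs_neg]; congr 1; simp [Finset.sum_neg_distrib]; ring
  simpa only [divisorBound, e1, e2] using this

end Divisors

/-- Division by `w` when only the imaginary part of `w` is bounded below; the real part comes from
`α`, on which nothing is assumed. -/
theorem norm_le_of_one_le_mul {D x : ℝ} {z y w : ℂ} (hx : 1 ≤ D * |x|) (hw : w.im = x)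
    (h : w * z = y) : ‖z‖ ≤ D * ‖y‖ := by
  have hD : 0 ≤ D := by
    by_contra hD
    nlinarith [mul_nonneg (neg_nonneg.2 (not_le.1 hD).le) (abs_nonneg x)]
  have h1 : |x| ≤ ‖w‖ := hw ▸ Complex.abs_im_le_norm w
  rw [← h, norm_mul]
  calc ‖z‖ ≤ D * |x| * ‖z‖ := le_mul_of_one_le_left (norm_nonneg _) hx
    _ ≤ D * (‖w‖ * ‖z‖) := by rw [mul_assoc]; gcongr

/-- Two real equations coupled by the rotation block of `Γ` decouple in the variables
`z₁ ± i z₂`, where the divisors are `κ ∓ β` up to a real part. -/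
theorem norm_le_of_rotation {κ α β D : ℝ} {z₁ z₂ y₁ y₂ : ℂ} (hm : 1 ≤ D * |κ - β|)
    (hp : 1 ≤ D * |κ + β|)
    (h₁ : -(Complex.I * κ * z₁) - (α * z₁ + β * z₂) = y₁)
    (h₂ : -(Complex.I * κ * z₂) - (-(β * z₁) + α * z₂) = y₂) :
    ‖z₁‖ ≤ D * (‖y₁‖ + ‖y₂‖) ∧ ‖z₂‖ ≤ D * (‖y₁‖ + ‖y₂‖) := by
  have hI : Complex.I * Complex.I = -1 := Complex.I_mul_I
  have hD : 0 ≤ D := by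
    by_contra hD
    nlinarith [mul_nonneg (neg_nonneg.2 (not_le.1 hD).le) (abs_nonneg (κ - β))]
  have hy₂ : ‖Complex.I * y₂‖ = ‖y₂‖ := by simp
  have e1 : ‖z₁ + Complex.I * z₂‖ ≤ D * (‖y₁‖ + ‖y₂‖) := by
    refine (norm_le_of_one_le_mul (x := -(κ - β)) (y := y₁ + Complex.I * y₂)
      (w := -(Complex.I * κ) - α + Complex.I * β) (by rwa [abs_neg]) (by simp; ring) ?_).trans
      (mul_le_mul_of_nonneg_left ((norm_add_le _ _).trans_eq (by rw [hy₂])) hD)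
    rw [← h₁, ← h₂]; linear_combination β * z₂ * hI
  have e2 : ‖z₁ - Complex.I * z₂‖ ≤ D * (‖y₁‖ + ‖y₂‖) := by
    refine (norm_le_of_one_le_mul (x := -(κ + β)) (y := y₁ - Complex.I * y₂)
      (w := -(Complex.I * κ) - α - Complex.I * β) (by rwa [abs_neg]) (by simp; ring) ?_).trans
      (mul_le_mul_of_nonneg_left ((norm_sub_le _ _).trans_eq (by rw [hy₂])) hD)
    rw [← h₁, ← h₂]; linear_combination β * z₂ * hI
  have n1 : ‖2 * z₁‖ = 2 * ‖z₁‖ := by simp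
  have n2 : ‖2 * (Complex.I * z₂)‖ = 2 * ‖z₂‖ := by simp
  constructor
  · have := norm_add_le (z₁ + Complex.I * z₂) (z₁ - Complex.I * z₂)
    rw [show z₁ + Complex.I * z₂ + (z₁ - Complex.I * z₂) = 2 * z₁ by ring, n1] at this
    linarith
  · have := norm_sub_le (z₁ + Complex.I * z₂) (z₁ - Complex.I * z₂)
    rw [show z₁ + Complex.I * z₂ - (z₁ - Complex.I * z₂) = 2 * (Complex.I * z₂) by ring, n2] at this
    linarith

end

/-! ### Analytic functions and Hamiltonian vector fields -/

section Calculus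

variable {E : Type*} [NormedAddCommGroup E] [NormedSpace ℝ E]

theorem fderiv_apply_comm {f : E → ℝ} {x : E} (hf : AnalyticAt ℝ f x) (v w : E) :
    fderiv ℝ (fun y => fderiv ℝ f y v) x w = fderiv ℝ (fun y => fderiv ℝ f y w) x v := by
  have h1 : DifferentiableAt ℝ (fderiv ℝ f) x := hf.fderiv.differentiableAt
  have h2 : IsSymmSndFDerivAt ℝ f x :=
    ContDiffAt.isSymmSndFDerivAt_of_omega (hf.contDiffAt)
  have h3 : ∀ v w, fderiv ℝ (fun y => fderiv ℝ f y v) x w = fderiv ℝ (fderiv ℝ f) x w v := by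
    intro v w
    rw [fderiv_clm_apply h1 (differentiableAt_const v)]
    simp
  rw [h3, h3]
  exact h2 w v

theorem analyticAt_fderiv_apply {f : E → ℝ} {x : E} (hf : AnalyticAt ℝ f x) (v : E) :
    AnalyticAt ℝ (fun y => fderiv ℝ f y v) x :=
  ((ContinuousLinearMap.apply ℝ ℝ v).analyticAt _).comp hf.fderiv

theorem analyticAt_det {p : Type*} [Fintype p] [DecidableEq p] {A : E → Matrix p p ℝ} {x : E}
    (hA : ∀ i j, AnalyticAt ℝ (fun y => A y i j) x) : AnalyticAt ℝ (fun y => (A y).det) x := by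
  simp only [Matrix.det_apply']
  refine Finset.analyticAt_fun_sum _ fun σ _ => ?_
  exact analyticAt_const.mul (Finset.analyticAt_fun_prod _ fun i _ => hA _ _)

theorem analyticAt_inv_apply {p : Type*} [Fintype p] [DecidableEq p] {A : E → Matrix p p ℝ} {x : E}
    (hA : ∀ i j, AnalyticAt ℝ (fun y => A y i j) x) (hx : (A x).det ≠ 0) (i j : p) :
    AnalyticAt ℝ (fun y => (A y)⁻¹ i j) x := by
  simp only [Matrix.inv_def, Ring.inverse_eq_inv', Matrix.smul_apply, smul_eq_mul,
    Matrix.adjugate_apply]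
  refine ((analyticAt_det hA).inv hx).mul (analyticAt_det fun k l => ?_)
  simp only [Matrix.updateRow_apply]
  split_ifs
  · exact analyticAt_const
  · exact hA k l

end Calculus

section Pderiv

variable {ι : Type*} [Fintype ι] [DecidableEq ι] {f g : (ι → ℝ) → ℝ} {x : ι → ℝ}

theorem analyticAt_pderiv (hf : AnalyticAt ℝ f x) (j : ι) :
    AnalyticAt ℝ (pderiv j f) x :=
  analyticAt_fderiv_apply hf _

theorem pderiv_comm (hf : AnalyticAt ℝ f x) (j k : ι) :
    pderiv j (pderiv k f) x = pderiv k (pderiv j f) x :=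
  fderiv_apply_comm hf _ _

theorem pderiv_sub (hf : AnalyticAt ℝ f x) (hg : AnalyticAt ℝ g x) (j : ι) :
    pderiv j (fun y => f y - g y) x = pderiv j f x - pderiv j g x := by
  simp [pderiv, fderiv_fun_sub hf.differentiableAt hg.differentiableAt]

theorem pderiv_sum_mul {κ : Type*} [Fintype κ] {f g : κ → (ι → ℝ) → ℝ}
    (hf : ∀ a, AnalyticAt ℝ (f a) x) (hg : ∀ a, AnalyticAt ℝ (g a) x) (j : ι) :
    pderiv j (fun y => ∑ a, f a y * g a y) x
      = ∑ a, (pderiv j (f a) x * g a x + f a x * pderiv j (g a) x) := by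
  unfold pderiv
  rw [fderiv_fun_sum fun a _ => ((hf a).fun_mul (hg a)).differentiableAt]
  simp only [sum_apply]
  refine Finset.sum_congr rfl fun a _ => ?_
  rw [fderiv_fun_mul (hf a).differentiableAt (hg a).differentiableAt]
  simp only [add_apply, smul_apply, smul_eq_mul]
  ring

/-- The differential in terms of the partial derivatives. -/
theorem fderiv_apply_eq_sum (f : (ι → ℝ) → ℝ) (x v : ι → ℝ) :
    fderiv ℝ f x v = ∑ j, pderiv j f x * v j := by
  conv_lhs => rw [pi_eq_sum_univ' v, map_sum]
  refine Finset.sum_congr rfl fun j _ => ?_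
  rw [map_smul, smul_eq_mul, mul_comm]
  rfl

end Pderiv

namespace PhaseSpace

variable {n : ℕ} (S : PhaseSpace n) {z : Fin (2 * n) → ℝ}

theorem Om_apply (z : Fin (2 * n) → ℝ) (i j : Fin (2 * n)) :
    S.Om z i j = pderiv i (fun y => S.a y j) z - pderiv j (fun y => S.a y i) z := rfl

theorem analyticAt_Om (hz : z ∈ S.U) (i j : Fin (2 * n)) :
    AnalyticAt ℝ (fun y => S.Om y i j) z :=
  (analyticAt_pderiv (S.analytic_a j z hz) i).sub (analyticAt_pderiv (S.analytic_a i z hz) j)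

theorem Om_transpose (z : Fin (2 * n) → ℝ) : (S.Om z)ᵀ = -S.Om z := by
  simp [Om, symplMatrix]

/-- The 2-form is closed. -/
theorem pderiv_Om_cyclic (hz : z ∈ S.U) (i j k : Fin (2 * n)) :
    pderiv i (fun y => S.Om y k j) z + pderiv k (fun y => S.Om y j i) z
      + pderiv j (fun y => S.Om y i k) z = 0 := by
  have h : ∀ a b, AnalyticAt ℝ (pderiv a fun y => S.a y b) z := fun a b =>
    analyticAt_pderiv (S.analytic_a b z hz) a
  have hc := fun a b c => pderiv_comm (S.analytic_a c z hz) a b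
  simp only [Om_apply]
  rw [pderiv_sub (h _ _) (h _ _), pderiv_sub (h _ _) (h _ _), pderiv_sub (h _ _) (h _ _),
    hc i k j, hc i j k, hc k j i]
  ring

variable {h : (Fin (2 * n) → ℝ) → ℝ}

theorem analyticAt_hamVF (hh : AnalyticOnNhd ℝ h S.U) (hz : z ∈ S.U) (i : Fin (2 * n)) :
    AnalyticAt ℝ (fun y => S.hamVF h y i) z := by
  simp only [hamVF, Matrix.mulVec, dotProduct]
  exact Finset.analyticAt_fun_sum _ fun j _ =>
    (analyticAt_inv_apply (S.analyticAt_Om hz) (S.nondegenerate z hz) i j).mul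
      (analyticAt_pderiv (hh z hz) j)

/-- The Lie derivative of the symplectic form along a Hamiltonian vector field is zero. -/
theorem lie_hamVF (hh : AnalyticOnNhd ℝ h S.U) (hz : z ∈ S.U) :
    (jacobian (S.hamVF h) z)ᵀ * S.Om z
      + (Matrix.of fun i j => fderiv ℝ (fun y => S.Om y i j) z (S.hamVF h z))
      + S.Om z * jacobian (S.hamVF h) z = 0 := by
  have hX := fun i => S.analyticAt_hamVF hh hz i
  have hO := fun i j => S.analyticAt_Om hz i j
  have h1 : ∀ k i, (S.Om z * jacobian (S.hamVF h) z) i k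
      = pderiv k (pderiv i h) z - ∑ j, pderiv k (fun y => S.Om y i j) z * S.hamVF h z j := by
    intro k i
    -- differentiate the equation `Ω X = (D h)ᵀ`
    have e : (fun y => ∑ j, S.Om y i j * S.hamVF h y j) =ᶠ[nhds z] pderiv i h := by
      filter_upwards [S.isOpen_U.mem_nhds hz] with y hy
      have : S.Om y *ᵥ S.hamVF h y = fun i => pderiv i h y := by
        rw [hamVF, Matrix.mulVec_mulVec, Matrix.mul_nonsing_inv (S.Om y)
          (isUnit_iff_ne_zero.2 (S.nondegenerate y hy)), Matrix.one_mulVec]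
      exact congrFun this i
    have e2 : pderiv k (fun y => ∑ j, S.Om y i j * S.hamVF h y j) z = pderiv k (pderiv i h) z := by
      unfold pderiv at e ⊢
      rw [e.fderiv_eq]
    rw [pderiv_sum_mul (fun j => hO i j) hX, Finset.sum_add_distrib] at e2
    rw [← e2, add_sub_cancel_left, Matrix.mul_apply]
    rfl
  have h2 : (jacobian (S.hamVF h) z)ᵀ * S.Om z = -(S.Om z * jacobian (S.hamVF h) z)ᵀ := by
    rw [Matrix.transpose_mul, Om_transpose, Matrix.mul_neg, neg_neg]
  rw [h2]
  ext i k
  simp only [Matrix.add_apply, Matrix.neg_apply, Matrix.transpose_apply, h1, Matrix.of_apply,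
    Matrix.zero_apply, fderiv_apply_eq_sum, pderiv_comm (hh z hz) i k]
  have h3 : ∑ j, (pderiv i (fun y => S.Om y k j) z + pderiv k (fun y => S.Om y j i) z
      + pderiv j (fun y => S.Om y i k) z) * S.hamVF h z j = 0 := by
    simp [S.pderiv_Om_cyclic hz]
  have h4 : ∀ j, pderiv k (fun y => S.Om y j i) z = -pderiv k (fun y => S.Om y i j) z := by
    intro j
    have : (fun y => S.Om y j i) = fun y => -S.Om y i j := by
      ext y; simp only [Om_apply]; ring
    simp [this, pderiv, fderiv_fun_neg]
  simp only [h4, add_mul, neg_mul, Finset.sum_add_distrib, Finset.sum_neg_distrib] at h3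
  linarith

end PhaseSpace

/-! ### Calculus on the torus -/

section Torus

variable {d : ℕ} {f g : (Fin d → ℝ) → ℝ}

namespace IsTorusAnalytic

theorem periodic (hf : IsTorusAnalytic f) : IsPeriodic (2 * Real.pi) f := fun k θ => hf.2 θ k

theorem analyticAt (hf : IsTorusAnalytic f) (θ : Fin d → ℝ) : AnalyticAt ℝ f θ := hf.1 θ trivial

theorem differentiable (hf : IsTorusAnalytic f) : Differentiable ℝ f :=
  fun θ => (hf.analyticAt θ).differentiableAt

theorem continuous (hf : IsTorusAnalytic f) : Continuous f := hf.differentiable.continuous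

theorem add (hf : IsTorusAnalytic f) (hg : IsTorusAnalytic g) :
    IsTorusAnalytic fun θ => f θ + g θ :=
  ⟨hf.1.add hg.1, fun θ k => by simp only [hf.2, hg.2]⟩

theorem mul (hf : IsTorusAnalytic f) (hg : IsTorusAnalytic g) :
    IsTorusAnalytic fun θ => f θ * g θ :=
  ⟨hf.1.mul hg.1, fun θ k => by simp only [hf.2, hg.2]⟩

theorem neg (hf : IsTorusAnalytic f) : IsTorusAnalytic fun θ => -f θ :=
  ⟨hf.1.neg, fun θ k => by simp only [hf.2]⟩

theorem const_mul (hf : IsTorusAnalytic f) (c : ℝ) : IsTorusAnalytic fun θ => c * f θ :=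
  ⟨analyticOnNhd_const.mul hf.1, fun θ k => by simp only [hf.2]⟩

theorem sub (hf : IsTorusAnalytic f) (hg : IsTorusAnalytic g) :
    IsTorusAnalytic fun θ => f θ - g θ :=
  ⟨hf.1.sub hg.1, fun θ k => by simp only [hf.2, hg.2]⟩

theorem sum {ι : Type*} {s : Finset ι} {f : ι → (Fin d → ℝ) → ℝ}
    (hf : ∀ i, IsTorusAnalytic (f i)) : IsTorusAnalytic fun θ => ∑ i ∈ s, f i θ :=
  ⟨Finset.analyticOnNhd_fun_sum _ fun i _ => (hf i).1, fun θ k => by simp only [(hf _).2]⟩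

theorem fderiv_apply (hf : IsTorusAnalytic f) (w : Fin d → ℝ) :
    IsTorusAnalytic fun θ => fderiv ℝ f θ w := by
  refine ⟨fun θ _ => analyticAt_fderiv_apply (hf.analyticAt θ) w, fun θ k => ?_⟩
  have : (fun θ => f (θ + Pi.single k (2 * Real.pi))) = f := funext fun θ => hf.2 θ k
  have h := fderiv_comp_add_right (𝕜 := ℝ) (f := f) (x := θ) (Pi.single k (2 * Real.pi))
  rw [this] at h
  exact congrArg (· w) h.symm

/-- The Fourier coefficients of a directional derivative. -/
theorem rcoef_fderiv (hf : IsTorusAnalytic f) (w : Fin d → ℝ) (k : Fin d → ℤ) :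
    rcoef (fun θ => fderiv ℝ f θ w) k
      = Complex.I * ((∑ i, (k i : ℝ) * w i : ℝ) : ℂ) * rcoef f k := by
  have hc := hf.continuous
  have hc' := (hf.fderiv_apply w).continuous
  have h := coef_deriv (w := w) (f := fun θ => (f θ : ℂ)) (f' := fun θ => (fderiv ℝ f θ w : ℂ))
    (fun i θ => congrArg _ (hf.2 θ i)) (by fun_prop)
    (fun i θ => congrArg _ ((hf.fderiv_apply w).2 θ i)) (by fun_prop) (fun θ => ?_) k
  · rw [rcoef, h]; push_cast; rfl
  · have h1 : HasFDerivAt f (fderiv ℝ f θ) (θ + (0 : ℝ) • w) := by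
      simpa using (hf.differentiable θ).hasFDerivAt
    have h2 : HasDerivAt (fun t : ℝ => θ + t • w) w 0 := by
      simpa using ((hasDerivAt_id (0 : ℝ)).smul_const w).const_add θ
    exact (h1.comp_hasDerivAt 0 h2).ofReal_comp

theorem rcoef_add (hf : IsTorusAnalytic f) (hg : IsTorusAnalytic g) (k : Fin d → ℤ) :
    rcoef (fun θ => f θ + g θ) k = rcoef f k + rcoef g k := by
  have h1 := hf.continuous
  have h2 := hg.continuous
  simp only [rcoef, Complex.ofReal_add]
  exact coef_add (fun i θ => congrArg Complex.ofReal (hf.2 θ i)) (by fun_prop)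
    (fun i θ => congrArg Complex.ofReal (hg.2 θ i)) (by fun_prop) k

end IsTorusAnalytic

theorem rcoef_const_mul (c : ℝ) (f : (Fin d → ℝ) → ℝ) (k : Fin d → ℤ) :
    rcoef (fun θ => c * f θ) k = c * rcoef f k := by
  simp only [rcoef, Complex.ofReal_mul]
  exact coef_const_mul _ _ _

theorem rcoef_neg (f : (Fin d → ℝ) → ℝ) (k : Fin d → ℤ) :
    rcoef (fun θ => -f θ) k = -rcoef f k := by
  simpa using rcoef_const_mul (-1) f k

theorem IsTorusAnalytic.rcoef_sub (hf : IsTorusAnalytic f) (hg : IsTorusAnalytic g)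
    (k : Fin d → ℤ) : rcoef (fun θ => f θ - g θ) k = rcoef f k - rcoef g k := by
  simp only [sub_eq_add_neg]
  rw [hf.rcoef_add hg.neg, rcoef_neg]

end Torus

/-! ### The linearised equations along the torus -/

section MatrixCalculus

variable {d : ℕ} {p q r : Type*}

/-- The directional derivative of a matrix function along `w`. -/
noncomputable def dirDeriv (w : Fin d → ℝ) (A : (Fin d → ℝ) → Matrix p q ℝ) (θ : Fin d → ℝ) :
    Matrix p q ℝ :=
  Matrix.of fun i j => fderiv ℝ (fun t => A t i j) θ w

/-- All entries are real-analytic on the torus. -/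
def MatAnalytic (A : (Fin d → ℝ) → Matrix p q ℝ) : Prop := ∀ i j, IsTorusAnalytic fun θ => A θ i j

theorem MatAnalytic.transpose {A : (Fin d → ℝ) → Matrix p q ℝ} (hA : MatAnalytic A) :
    MatAnalytic fun θ => (A θ)ᵀ := fun i j => hA j i

theorem MatAnalytic.mul [Fintype q] {A : (Fin d → ℝ) → Matrix p q ℝ}
    {B : (Fin d → ℝ) → Matrix q r ℝ} (hA : MatAnalytic A) (hB : MatAnalytic B) :
    MatAnalytic fun θ => A θ * B θ := fun i j =>
  IsTorusAnalytic.sum fun l => (hA i l).mul (hB l j)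

theorem dirDeriv_transpose (w : Fin d → ℝ) (A : (Fin d → ℝ) → Matrix p q ℝ) (θ : Fin d → ℝ) :
    dirDeriv w (fun θ => (A θ)ᵀ) θ = (dirDeriv w A θ)ᵀ := rfl

theorem dirDeriv_mul [Fintype q] {A : (Fin d → ℝ) → Matrix p q ℝ}
    {B : (Fin d → ℝ) → Matrix q r ℝ} (hA : MatAnalytic A) (hB : MatAnalytic B) (w θ : Fin d → ℝ) :
    dirDeriv w (fun θ => A θ * B θ) θ = dirDeriv w A θ * B θ + A θ * dirDeriv w B θ := by
  ext i j
  simp only [dirDeriv, Matrix.of_apply, Matrix.mul_apply, Matrix.add_apply,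
    ← Finset.sum_add_distrib]
  rw [fderiv_fun_sum fun l _ => ((hA i l).mul (hB l j)).differentiable θ]
  simp only [sum_apply]
  refine Finset.sum_congr rfl fun l _ => ?_
  rw [fderiv_fun_mul ((hA i l).differentiable θ) ((hB l j).differentiable θ)]
  simp only [add_apply, smul_apply, smul_eq_mul]
  ring

end MatrixCalculus

section Torus

variable {n d m : ℕ} {S : PhaseSpace n} {K : (Fin d → ℝ) → Fin (2 * n) → ℝ}

theorem IsTorusAnalytic.comp (hK : ∀ i, IsTorusAnalytic fun θ => K θ i) (hU : ∀ θ, K θ ∈ S.U)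
    {g : (Fin (2 * n) → ℝ) → ℝ} (hg : ∀ z ∈ S.U, AnalyticAt ℝ g z) :
    IsTorusAnalytic fun θ => g (K θ) := by
  refine ⟨fun θ _ => (hg _ (hU θ)).comp (AnalyticAt.pi fun i => (hK i).analyticAt θ),
    fun θ k => congrArg g (funext fun i => (hK i).2 θ k)⟩

theorem fderiv_comp_torus (hK : ∀ i, IsTorusAnalytic fun θ => K θ i)
    {g : (Fin (2 * n) → ℝ) → ℝ} {θ : Fin d → ℝ} (hg : AnalyticAt ℝ g (K θ)) (w : Fin d → ℝ) :
    fderiv ℝ (fun t => g (K t)) θ w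
      = fderiv ℝ g (K θ) fun i => fderiv ℝ (fun t => K t i) θ w := by
  have h1 : HasFDerivAt K (ContinuousLinearMap.pi fun i => fderiv ℝ (fun t => K t i) θ) θ :=
    hasFDerivAt_pi.2 fun i => ((hK i).differentiable θ).hasFDerivAt
  have h2 := (hg.differentiableAt.hasFDerivAt.comp θ h1).fderiv
  exact congrArg (· w) h2

theorem matAnalytic_matL (hK : ∀ i, IsTorusAnalytic fun θ => K θ i) : MatAnalytic (matL K) :=
  fun i _ => (hK i).fderiv_apply _

theorem matAnalytic_Om (hK : ∀ i, IsTorusAnalytic fun θ => K θ i) (hU : ∀ θ, K θ ∈ S.U) :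
    MatAnalytic fun θ => S.Om (K θ) :=
  fun i j => IsTorusAnalytic.comp hK hU fun _ hz => S.analyticAt_Om hz i j

theorem matAnalytic_OmPair (hK : ∀ i, IsTorusAnalytic fun θ => K θ i) (hU : ∀ θ, K θ ∈ S.U)
    {p q : Type*} {V₁ : (Fin d → ℝ) → Matrix (Fin (2 * n)) p ℝ}
    {V₂ : (Fin d → ℝ) → Matrix (Fin (2 * n)) q ℝ} (h₁ : MatAnalytic V₁) (h₂ : MatAnalytic V₂) :
    MatAnalytic (OmPair S K V₁ V₂) :=
  (h₁.transpose.mul (matAnalytic_Om hK hU)).mul h₂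

variable {h : (Fin (2 * n) → ℝ) → ℝ} {ω : Fin d → ℝ}

theorem isTorusAnalytic_errK (hh : AnalyticOnNhd ℝ h S.U)
    (hK : ∀ i, IsTorusAnalytic fun θ => K θ i) (hU : ∀ θ, K θ ∈ S.U) (i : Fin (2 * n)) :
    IsTorusAnalytic fun θ => errK S h ω K θ i :=
  ((hK i).fderiv_apply ω).neg.add
    (IsTorusAnalytic.comp hK hU fun _ hz => S.analyticAt_hamVF hh hz i)

/-- The derivative of the invariance equation of the torus: `L` solves the linearised equation
with error `D E_K`. -/
theorem dirDeriv_matL (hh : AnalyticOnNhd ℝ h S.U) (hK : ∀ i, IsTorusAnalytic fun θ => K θ i)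
    (hU : ∀ θ, K θ ∈ S.U) (θ : Fin d → ℝ) :
    dirDeriv ω (matL K) θ
      = jacobian (S.hamVF h) (K θ) * matL K θ - jacobian (errK S h ω K) θ := by
  ext i j
  have hX := S.analyticAt_hamVF hh (hU θ) i
  have h1 : pderiv j (fun y => errK S h ω K y i) θ
      = -fderiv ℝ (fun t => fderiv ℝ (fun s => K s i) t (Pi.single j 1)) θ ω
        + ∑ l, pderiv l (fun y => S.hamVF h y i) (K θ) * matL K θ l j := by
    have e1 : DifferentiableAt ℝ (fun t => -(fderiv ℝ (fun s => K s i) t ω)) θ :=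
      ((hK i).fderiv_apply ω).neg.differentiable θ
    have e2 : DifferentiableAt ℝ (fun t => S.hamVF h (K t) i) θ :=
      (IsTorusAnalytic.comp hK hU fun _ hz => S.analyticAt_hamVF hh hz i).differentiable θ
    have e3 := fderiv_comp_torus hK hX (Pi.single j 1)
    rw [fderiv_apply_eq_sum (fun y => S.hamVF h y i)] at e3
    rw [pderiv]
    simp only [errK, lieOp]
    rw [fderiv_fun_add e1 e2, add_apply, e3, fderiv_fun_neg, neg_apply,
      fderiv_apply_comm ((hK i).analyticAt θ)]
    rfl
  simp only [dirDeriv, Matrix.sub_apply, Matrix.mul_apply, jacobian, Matrix.of_apply] at h1 ⊢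
  rw [h1]
  simp only [matL, jacobian, pderiv, Matrix.of_apply]
  ring

/-- The right-hand side of the cohomological equation for `Ω_{LV}`, where `R` is the error in the
linearised equation for `V`. -/
noncomputable def cohomErr (S : PhaseSpace n) (h : (Fin (2 * n) → ℝ) → ℝ) (ω : Fin d → ℝ)
    (K : (Fin d → ℝ) → Fin (2 * n) → ℝ) {q : Type*}
    (V R : (Fin d → ℝ) → Matrix (Fin (2 * n)) q ℝ) (θ : Fin d → ℝ) : Matrix (Fin d) q ℝ :=
  (jacobian (errK S h ω K) θ)ᵀ * S.Om (K θ) * V θ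
    + (matL K θ)ᵀ * (Matrix.of fun i j => fderiv ℝ (fun z => S.Om z i j) (K θ) (errK S h ω K θ))
      * V θ
    + (matL K θ)ᵀ * S.Om (K θ) * R θ

/-- The cohomological equation for `Ω_{LV}`: the terms without errors cancel since the Lie
derivative of the symplectic form along the Hamiltonian vector field is zero. -/
theorem dirDeriv_OmPair (hh : AnalyticOnNhd ℝ h S.U) (hK : ∀ i, IsTorusAnalytic fun θ => K θ i)
    (hU : ∀ θ, K θ ∈ S.U) {q : Type*} [Fintype q] {V R : (Fin d → ℝ) → Matrix (Fin (2 * n)) q ℝ}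
    (hV : MatAnalytic V) (Γ : Matrix q q ℝ) {θ : Fin d → ℝ}
    (hR : dirDeriv ω V θ = jacobian (S.hamVF h) (K θ) * V θ - R θ - V θ * Γ) :
    dirDeriv ω (OmPair S K (matL K) V) θ
      = -cohomErr S h ω K V R θ - OmPair S K (matL K) V θ * Γ := by
  have hL := matAnalytic_matL hK
  have hO := matAnalytic_Om hK hU
  have hlie := S.lie_hamVF hh (hU θ)
  have hdO : dirDeriv ω (fun θ => S.Om (K θ)) θ
      = (Matrix.of fun i j => fderiv ℝ (fun y => S.Om y i j) (K θ) (S.hamVF h (K θ)))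
        - Matrix.of fun i j => fderiv ℝ (fun z => S.Om z i j) (K θ) (errK S h ω K θ) := by
    ext i j
    simp only [dirDeriv, Matrix.of_apply, Matrix.sub_apply]
    rw [fderiv_comp_torus hK (S.analyticAt_Om (hU θ) i j), ← map_sub]
    congr 1
    ext l
    simp [errK, lieOp]
  unfold OmPair cohomErr
  rw [dirDeriv_mul (hL.transpose.mul hO) hV, dirDeriv_mul hL.transpose hO, dirDeriv_transpose,
    dirDeriv_matL hh hK hU, hR, hdO]
  generalize (jacobian (S.hamVF h) (K θ)) = X at *
  generalize (jacobian (errK S h ω K) θ) = E at *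
  generalize (Matrix.of fun i j => fderiv ℝ (fun y => S.Om y i j) (K θ) (S.hamVF h (K θ))) = Y at *
  generalize (Matrix.of fun i j =>
    fderiv ℝ (fun z => S.Om z i j) (K θ) (errK S h ω K θ)) = Z at *
  have hY : Y = -(Xᵀ * S.Om (K θ)) - S.Om (K θ) * X := by
    rw [eq_sub_iff_add_eq, eq_neg_iff_add_eq_zero, ← hlie]; abel
  rw [hY]
  simp only [Matrix.transpose_sub, Matrix.transpose_mul, Matrix.add_mul,
    Matrix.mul_sub, Matrix.sub_mul, Matrix.mul_neg, Matrix.neg_mul, Matrix.mul_assoc]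
  abel

/-- Since the symplectic form is exact, `Ω_{LL}` is a curl. -/
theorem OmPair_LL_eq_curl (hK : ∀ i, IsTorusAnalytic fun θ => K θ i) (hU : ∀ θ, K θ ∈ S.U)
    (i j : Fin d) (θ : Fin d → ℝ) :
    OmPair S K (matL K) (matL K) θ i j
      = pderiv i (fun t => ∑ l, S.a (K t) l * matL K t l j) θ
        - pderiv j (fun t => ∑ l, S.a (K t) l * matL K t l i) θ := by
  have ha := fun l => (IsTorusAnalytic.comp hK hU (S.analytic_a l)).analyticAt θ
  have hL := fun l j => (matAnalytic_matL hK l j).analyticAt θ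
  have hcomm : ∀ l, pderiv i (fun t => matL K t l j) θ = pderiv j (fun t => matL K t l i) θ :=
    fun l => pderiv_comm ((hK l).analyticAt θ) i j
  have hchain : ∀ l i, pderiv i (fun t => S.a (K t) l) θ
      = ∑ k, pderiv k (fun y => S.a y l) (K θ) * matL K θ k i := fun l i => by
    rw [pderiv, fderiv_comp_torus hK (S.analytic_a l _ (hU θ)),
      fderiv_apply_eq_sum (fun y => S.a y l)]
    rfl
  rw [pderiv_sum_mul ha (fun l => hL l j), pderiv_sum_mul ha (fun l => hL l i)]
  simp only [hcomm, Finset.sum_add_distrib, add_sub_add_right_eq_sub, hchain]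
  simp only [OmPair, Matrix.mul_apply, Matrix.transpose_apply, PhaseSpace.Om_apply, Finset.sum_mul,
    mul_sub, sub_mul, Finset.sum_sub_distrib]
  congr 1
  · refine Finset.sum_congr rfl fun l _ => Finset.sum_congr rfl fun k _ => ?_
    ring
  · rw [Finset.sum_comm]
    refine Finset.sum_congr rfl fun l _ => Finset.sum_congr rfl fun k _ => ?_
    ring

theorem rcoef_OmPair_LL_zero (hK : ∀ i, IsTorusAnalytic fun θ => K θ i) (hU : ∀ θ, K θ ∈ S.U)
    (i j : Fin d) : rcoef (fun θ => OmPair S K (matL K) (matL K) θ i j) 0 = 0 := by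
  have h1 : ∀ j, IsTorusAnalytic fun t => ∑ l, S.a (K t) l * matL K t l j := fun j =>
    IsTorusAnalytic.sum fun l =>
      (IsTorusAnalytic.comp hK hU (S.analytic_a l)).mul (matAnalytic_matL hK l j)
  simp only [OmPair_LL_eq_curl hK hU, pderiv]
  rw [((h1 j).fderiv_apply _).rcoef_sub ((h1 i).fderiv_apply _), (h1 j).rcoef_fderiv,
    (h1 i).rcoef_fderiv]
  simp

end Torus

/-! ### Estimates of `Ω_{LL}` and `Ω_{LW}` -/

section Estimates

variable {n d m : ℕ}

theorem subExp_absSum : SubExp (absSum (d := d)) := by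
  simpa only [Real.rpow_one] using subExp_rpow_absSum (d := d) 1

/-- Cauchy estimates for the partial derivatives. -/
theorem exists_hasBound_pderiv (d : ℕ) {ρ ρ' : ℝ} (hρ' : 0 < ρ') (hρ : ρ' < ρ) :
    ∃ c ≥ 0, ∀ (f : (Fin d → ℝ) → ℝ) (b : ℝ), IsTorusAnalytic f → HasBound ρ f b →
      ∀ j, HasBound ρ' (pderiv j f) (c * b) := by
  obtain ⟨c, hc, h⟩ := (subExp_absSum (d := d)).exists_hasBound hρ' hρ
  refine ⟨c, hc, fun f b hf hb j => h _ f f b (hf.fderiv_apply _).periodic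
    (hf.fderiv_apply _).continuous hf.periodic hf.periodic hb hb fun k => ?_⟩
  have h1 := hf.rcoef_fderiv (Pi.single j 1) k
  change rcoef (pderiv j f) k = _ at h1
  rw [h1, norm_mul, norm_mul, Complex.norm_I, one_mul, Complex.norm_real]
  have h2 : |∑ i, (k i : ℝ) * (Pi.single j 1 : Fin d → ℝ) i| ≤ absSum k := by
    simpa [Pi.single_apply, absSum] using Finset.single_le_sum (f := fun l => |(k l : ℝ)|)
      (fun _ _ => abs_nonneg _) (Finset.mem_univ j)
  refine mul_le_mul h2 (le_add_of_nonneg_left (norm_nonneg _)) (norm_nonneg _) (absSum_nonneg k)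

variable {S : PhaseSpace n} {K : (Fin d → ℝ) → Fin (2 * n) → ℝ} {h : (Fin (2 * n) → ℝ) → ℝ}
  {ω : Fin d → ℝ}

/-- The right-hand side of the cohomological equation is linear in the errors. -/
theorem matBound_cohomErr {q : Type*} {V R : (Fin d → ℝ) → Matrix (Fin (2 * n)) q ℝ}
    {ρ M b κ : ℝ} (hL : MatBound ρ (matL K) M) (hO : MatBound ρ (fun θ => S.Om (K θ)) M)
    (hDO : ∀ k, MatBound ρ
      (fun θ => Matrix.of fun i j => pderiv k (fun z => S.Om z i j) (K θ)) M)
    (hE : ∀ i, HasBound ρ (fun θ => errK S h ω K θ i) b)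
    (hDE : MatBound ρ (jacobian (errK S h ω K)) (κ * b)) (hV : MatBound ρ V M)
    (hR : MatBound ρ R (κ * b)) :
    MatBound ρ (cohomErr S h ω K V R)
      (((2 * n : ℕ) ^ 2 * M ^ 2 * (2 * κ + (2 * n : ℕ) * M)) * b) := by
  have hZ : MatBound ρ (fun θ => Matrix.of fun i j =>
      fderiv ℝ (fun z => S.Om z i j) (K θ) (errK S h ω K θ)) ((2 * n : ℕ) * (M * b)) := by
    intro i j
    have := HasBound.sum Finset.univ fun k => (hDO k i j).mul (hE k)
    simp only [Finset.card_univ, Fintype.card_fin] at this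
    simp only [Matrix.of_apply, fderiv_apply_eq_sum (fun z => S.Om z i j)]
    exact this
  refine (((hDE.transpose.mul hO).mul hV).add ((hL.transpose.mul hZ).mul hV) |>.add
    ((hL.transpose.mul hO).mul hR)).mono (le_of_eq ?_)
  simp only [Fintype.card_fin]
  ring

/-- The invariance errors control `Ω_{LL}` and `Ω_{LW}`. -/
theorem exists_matBound_OmPair {ω : Fin d → ℝ} {β : Fin m → ℝ} {γ τ : ℝ} (n : ℕ)
    (hDM : DiophantineMelnikov ω β γ τ) {ρ ρ' : ℝ} (hρ' : 0 < ρ') (hρ : ρ' < ρ) {M : ℝ}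
    (hM : 0 ≤ M) :
    ∃ c ≥ 0, ∀ (S : PhaseSpace n) (h : (Fin (2 * n) → ℝ) → ℝ) (α : Fin m → ℝ)
      (K : (Fin d → ℝ) → Fin (2 * n) → ℝ)
      (W : (Fin d → ℝ) → Matrix (Fin (2 * n)) (Fin m ⊕ Fin m) ℝ) (b : ℝ),
      AnalyticOnNhd ℝ h S.U → IsFrameData S K W →
      MatBound ρ (matL K) M → MatBound ρ W M → MatBound ρ (fun θ => S.Om (K θ)) M →
      (∀ k, MatBound ρ
        (fun θ => Matrix.of fun i j => pderiv k (fun z => S.Om z i j) (K θ)) M) →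
      (∀ i, HasBound ρ (fun θ => errK S h ω K θ i) b) →
      MatBound ρ (errW S h ω α β K W) b →
      MatBound ρ' (OmPair S K (matL K) (matL K)) (c * b) ∧
        MatBound ρ' (OmPair S K (matL K) W) (c * b) := by
  -- the Cauchy estimate takes the width from `ρ` to `r`, the small divisors from `r` to `ρ'`
  set r := (ρ + ρ') / 2 with hr
  have hr1 : ρ' < r := by rw [hr]; linarith
  have hr2 : r < ρ := by rw [hr]; linarith
  have hr0 : 0 < r := hρ'.trans hr1
  obtain ⟨c₁, hc₁, hpd⟩ := exists_hasBound_pderiv d hr0 hr2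
  obtain ⟨c₂, hc₂, hsd⟩ := hDM.subExp_divisorBound.exists_hasBound hρ' hr1
  set c₃ : ℝ := (2 * n : ℕ) ^ 2 * M ^ 2 * (2 * (c₁ + 1) + (2 * n : ℕ) * M) with hc₃
  refine ⟨c₂ * c₃, by positivity, ?_⟩
  intro S h α K W b hh hF hL hW hO hDO hE hEW
  have hK := hF.analytic_K
  have hU := hF.mapsTo
  have haL := matAnalytic_matL hK
  have haW : MatAnalytic W := hF.analytic_W
  have hDE : MatBound r (jacobian (errK S h ω K)) (c₁ * b) := fun i j =>
    hpd _ b (isTorusAnalytic_errK hh hK hU i) (hE i) j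
  have hDE' : MatBound r (jacobian (errK S h ω K)) ((c₁ + 1) * b) := fun i j =>
    (hDE i j).mono (by nlinarith [(hE i).nonneg (hr0.trans hr2)])
  have hEr := fun i => (hE i).restrict hr2.le
  have hDOr := fun k => (hDO k).restrict hr2.le
  constructor
  · have hv := matBound_cohomErr (hL.restrict hr2.le) (hO.restrict hr2.le) hDOr hEr hDE'
      (hL.restrict hr2.le) hDE'
    rw [← hc₃] at hv
    intro i j
    have hu := matAnalytic_OmPair (S := S) hK hU haL haL i j
    have he : (fun θ => cohomErr S h ω K (matL K) (jacobian (errK S h ω K)) θ i j)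
        = fun θ => -fderiv ℝ (fun t => OmPair S K (matL K) (matL K) t i j) θ ω := by
      funext θ
      have := dirDeriv_OmPair hh hK hU haL 0 (θ := θ) (ω := ω) (R := jacobian (errK S h ω K))
        (by rw [dirDeriv_matL hh hK hU, Matrix.mul_zero, sub_zero])
      have := congrFun (congrFun this i) j
      simp only [Matrix.mul_zero, sub_zero, dirDeriv, Matrix.of_apply, Matrix.neg_apply] at this
      rw [this, neg_neg]
    have hv' := hv i j
    rw [he] at hv'
    have hper := (hu.fderiv_apply ω).neg.periodic
    rw [mul_assoc]
    refine hsd _ _ _ _ hu.periodic hu.continuous hper hper hv' hv' fun k => ?_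
    by_cases hk : k = 0
    · -- the divisor vanishes, but so does the mean value of `Ω_{LL}`
      rw [hk, rcoef_OmPair_LL_zero hK hU, rcoef_neg, hu.rcoef_fderiv]
      simp
    · have h1 := norm_le_of_one_le_mul (D := divisorBound β γ τ k)
        (x := -∑ l, (k l : ℝ) * ω l) (by rw [abs_neg]; exact hDM.one_le_mul_freq hk)
        (w := -(Complex.I * (∑ l, (k l : ℝ) * ω l : ℝ))) (by simp)
        (z := rcoef (fun θ => OmPair S K (matL K) (matL K) θ i j) k) rfl
      rw [rcoef_neg, hu.rcoef_fderiv, ← neg_mul, mul_add]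
      exact h1.trans (le_add_of_nonneg_left ((norm_nonneg _).trans h1))
  · have hEW' : MatBound r (errW S h ω α β K W) ((c₁ + 1) * b) := fun i j =>
      ((hEW i j).restrict hr2.le).mono (by nlinarith [(hEW i j).nonneg (hr0.trans hr2)])
    have hv := matBound_cohomErr (hL.restrict hr2.le) (hO.restrict hr2.le) hDOr hEr hDE'
      (hW.restrict hr2.le) hEW'
    rw [← hc₃] at hv
    have hu := matAnalytic_OmPair (S := S) hK hU haL haW
    have hdu : ∀ θ, dirDeriv ω (OmPair S K (matL K) W) θ
        = -cohomErr S h ω K W (errW S h ω α β K W) θ - OmPair S K (matL K) W θ * Gam α β :=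
      fun θ => dirDeriv_OmPair hh hK hU haW (Gam α β) (by
        ext i j
        simp only [errW, lieOp, dirDeriv, Matrix.sub_apply, Matrix.add_apply, Matrix.of_apply]
        ring)
    intro i
    set u₁ : Fin m → (Fin d → ℝ) → ℝ := fun l θ => OmPair S K (matL K) W θ i (Sum.inl l) with hu₁
    set u₂ : Fin m → (Fin d → ℝ) → ℝ := fun l θ => OmPair S K (matL K) W θ i (Sum.inr l) with hu₂
    have ha₁ : ∀ l, IsTorusAnalytic (u₁ l) := fun l => hu i _
    have ha₂ : ∀ l, IsTorusAnalytic (u₂ l) := fun l => hu i _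
    have he₁ : ∀ l, (fun θ => cohomErr S h ω K W (errW S h ω α β K W) θ i (Sum.inl l))
        = fun θ => -fderiv ℝ (u₁ l) θ ω - (α l * u₁ l θ + β l * u₂ l θ) := by
      intro l; funext θ
      have := congrFun (congrFun (hdu θ) i) (Sum.inl l)
      simp only [dirDeriv, Matrix.of_apply, Matrix.sub_apply, Matrix.neg_apply, Matrix.mul_apply,
        Fintype.sum_sum_type, Gam, Matrix.fromBlocks_apply₁₁, Matrix.fromBlocks_apply₂₁,
        Matrix.diagonal_apply, mul_ite, mul_zero, Finset.sum_ite_eq', Finset.mem_univ,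
        if_true] at this
      simp only [hu₁, hu₂, this]
      ring
    have he₂ : ∀ l, (fun θ => cohomErr S h ω K W (errW S h ω α β K W) θ i (Sum.inr l))
        = fun θ => -fderiv ℝ (u₂ l) θ ω - (-(β l * u₁ l θ) + α l * u₂ l θ) := by
      intro l; funext θ
      have := congrFun (congrFun (hdu θ) i) (Sum.inr l)
      simp only [dirDeriv, Matrix.of_apply, Matrix.sub_apply, Matrix.neg_apply, Matrix.mul_apply,
        Fintype.sum_sum_type, Gam, Matrix.fromBlocks_apply₁₂, Matrix.fromBlocks_apply₂₂,
        Matrix.diagonal_apply, mul_ite, mul_zero, mul_neg, Finset.sum_neg_distrib,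
        Finset.sum_ite_eq', Finset.mem_univ, if_true] at this
      simp only [hu₁, hu₂, this]
      ring
    have hv₁ := fun l => hv i (Sum.inl l)
    have hv₂ := fun l => hv i (Sum.inr l)
    simp only [he₁] at hv₁
    simp only [he₂] at hv₂
    have hb₁ : ∀ l, IsTorusAnalytic fun θ =>
        -fderiv ℝ (u₁ l) θ ω - (α l * u₁ l θ + β l * u₂ l θ) := fun l =>
      ((ha₁ l).fderiv_apply ω).neg.sub (((ha₁ l).const_mul _).add ((ha₂ l).const_mul _))
    have hb₂ : ∀ l, IsTorusAnalytic fun θ =>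
        -fderiv ℝ (u₂ l) θ ω - (-(β l * u₁ l θ) + α l * u₂ l θ) := fun l =>
      ((ha₂ l).fderiv_apply ω).neg.sub (((ha₁ l).const_mul _).neg.add ((ha₂ l).const_mul _))
    have key : ∀ l k, _ ∧ _ := fun l k =>
      norm_le_of_rotation (hDM.one_le_mul_freq_sub k l) (hDM.one_le_mul_freq_add k l)
        (α := α l) (z₁ := rcoef (u₁ l) k) (z₂ := rcoef (u₂ l) k)
        (y₁ := rcoef (fun θ => -fderiv ℝ (u₁ l) θ ω - (α l * u₁ l θ + β l * u₂ l θ)) k)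
        (y₂ := rcoef (fun θ => -fderiv ℝ (u₂ l) θ ω - (-(β l * u₁ l θ) + α l * u₂ l θ)) k)
        (by
          rw [((ha₁ l).fderiv_apply ω).neg.rcoef_sub
              (((ha₁ l).const_mul _).add ((ha₂ l).const_mul _)),
            ((ha₁ l).const_mul _).rcoef_add ((ha₂ l).const_mul _), rcoef_neg,
            (ha₁ l).rcoef_fderiv, rcoef_const_mul, rcoef_const_mul])
        (by
          rw [((ha₂ l).fderiv_apply ω).neg.rcoef_sub
              (((ha₁ l).const_mul _).neg.add ((ha₂ l).const_mul _)),
            ((ha₁ l).const_mul _).neg.rcoef_add ((ha₂ l).const_mul _), rcoef_neg, rcoef_neg,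
            (ha₂ l).rcoef_fderiv, rcoef_const_mul, rcoef_const_mul])
    rw [mul_assoc]
    rintro (l | l)
    · exact hsd _ _ _ _ (ha₁ l).periodic (ha₁ l).continuous (hb₁ l).periodic (hb₂ l).periodic
        (hv₁ l) (hv₂ l) fun k => (key l k).1
    · exact hsd _ _ _ _ (ha₂ l).periodic (ha₂ l).continuous (hb₁ l).periodic (hb₂ l).periodic
        (hv₁ l) (hv₂ l) fun k => (key l k).2

end Estimates

/-! ### Symplecticity of the frame -/

section Frame

variable {n d m : ℕ}

theorem PhaseSpace.G_transpose (S : PhaseSpace n) {z : Fin (2 * n) → ℝ} (hz : z ∈ S.U) :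
    (S.G z)ᵀ = S.G z := by
  simpa [Matrix.conjTranspose_eq_transpose_of_trivial] using! (S.posDef_G z hz).isHermitian.eq

theorem PhaseSpace.Om_mul_J (S : PhaseSpace n) {z : Fin (2 * n) → ℝ} (hz : z ∈ S.U) :
    S.Om z * S.J z = -S.G z := by
  have h : (S.J z)ᵀ * S.Om z = S.G z := S.compatible z hz
  have h2 := congrArg Matrix.transpose h
  rw [Matrix.transpose_mul, Matrix.transpose_transpose, S.Om_transpose, S.G_transpose hz,
    Matrix.neg_mul] at h2
  rw [← h2, neg_neg]

theorem PhaseSpace.G_mul_J (S : PhaseSpace n) {z : Fin (2 * n) → ℝ} (hz : z ∈ S.U) :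
    S.G z * S.J z = S.Om z := by
  rw [← neg_neg (S.G z), ← S.Om_mul_J hz, Matrix.neg_mul, Matrix.mul_assoc, S.J_mul_J z hz,
    Matrix.mul_neg, Matrix.mul_one, neg_neg]

variable {S : PhaseSpace n} {K : (Fin d → ℝ) → Fin (2 * n) → ℝ}
  {W : (Fin d → ℝ) → Matrix (Fin (2 * n)) (Fin m ⊕ Fin m) ℝ}

theorem OmPair_transpose {p q : Type*} (V₁ : (Fin d → ℝ) → Matrix (Fin (2 * n)) p ℝ)
    (V₂ : (Fin d → ℝ) → Matrix (Fin (2 * n)) q ℝ) (θ : Fin d → ℝ) :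
    (OmPair S K V₁ V₂ θ)ᵀ = -OmPair S K V₂ V₁ θ := by
  simp [OmPair, S.Om_transpose, Matrix.mul_assoc]

theorem GPair_transpose (hU : ∀ θ, K θ ∈ S.U) {p q : Type*}
    (V₁ : (Fin d → ℝ) → Matrix (Fin (2 * n)) p ℝ) (V₂ : (Fin d → ℝ) → Matrix (Fin (2 * n)) q ℝ)
    (θ : Fin d → ℝ) : (GPair S K V₁ V₂ θ)ᵀ = GPair S K V₂ V₁ θ := by
  simp [GPair, S.G_transpose (hU θ), Matrix.mul_assoc]

theorem GPair_mul_matB (hF : IsFrameData S K W) (θ : Fin d → ℝ) :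
    GPair S K (matL K) (matL K) θ * matB S K θ = 1 :=
  Matrix.mul_nonsing_inv _ ((Matrix.isUnit_iff_isUnit_det _).1 (hF.invertible_GLL θ))

theorem OmPair_mul_matC (hF : IsFrameData S K W) (θ : Fin d → ℝ) :
    OmPair S K W W θ * matC S K W θ = GPair S K W (matL K) θ * matB S K θ := by
  rw [matC, ← Matrix.mul_assoc, ← Matrix.mul_assoc,
    Matrix.mul_nonsing_inv _ ((Matrix.isUnit_iff_isUnit_det _).1 (hF.invertible_OmWW θ)),
    Matrix.one_mul]

theorem matA_transpose (θ : Fin d → ℝ) : (matA S K W θ)ᵀ = -matA S K W θ := by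
  simp [matA, OmPair_transpose, Matrix.mul_assoc]

/-- The factor `1/2` in `A` is what cancels the contributions of `C` to `Nᵀ Ω N`. -/
theorem two_matA (θ : Fin d → ℝ) :
    (matC S K W θ)ᵀ * OmPair S K W W θ * matC S K W θ = matA S K W θ + matA S K W θ := by
  rw [matA, ← add_smul]; norm_num

/-- `V₁ᵀ Ω N` for an arbitrary `V₁`. -/
theorem OmPair_matN (hF : IsFrameData S K W) {p : Type*}
    (V : (Fin d → ℝ) → Matrix (Fin (2 * n)) p ℝ) (θ : Fin d → ℝ) :
    OmPair S K V (matN S K W) θ = OmPair S K V (matL K) θ * matA S K W θ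
      - GPair S K V (matL K) θ * matB S K θ + OmPair S K V W θ * matC S K W θ := by
  have h : S.Om (K θ) * (S.J (K θ) * matL K θ * matB S K θ)
      = -(S.G (K θ) * matL K θ * matB S K θ) := by
    rw [← Matrix.mul_assoc, ← Matrix.mul_assoc, S.Om_mul_J (hF.mapsTo θ), Matrix.neg_mul,
      Matrix.neg_mul]
  rw [OmPair, matN, Matrix.mul_assoc, Matrix.mul_add, Matrix.mul_add (S.Om (K θ)), h]
  simp only [OmPair, GPair, Matrix.mul_add, Matrix.mul_neg, Matrix.mul_assoc, sub_eq_add_neg]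

theorem OmPair_matL_matN (hF : IsFrameData S K W) (θ : Fin d → ℝ) :
    OmPair S K (matL K) (matN S K W) θ = -1 + (OmPair S K (matL K) (matL K) θ * matA S K W θ
      + OmPair S K (matL K) W θ * matC S K W θ) := by
  rw [OmPair_matN hF, GPair_mul_matB hF]; abel

theorem OmPair_W_matN (hF : IsFrameData S K W) (θ : Fin d → ℝ) :
    OmPair S K W (matN S K W) θ = -((OmPair S K (matL K) W θ)ᵀ * matA S K W θ) := by
  rw [OmPair_matN hF, OmPair_mul_matC hF, OmPair_transpose, Matrix.neg_mul, neg_neg,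
    sub_add_cancel]

theorem OmPair_matN_matN (hF : IsFrameData S K W) (θ : Fin d → ℝ) :
    OmPair S K (matN S K W) (matN S K W) θ =
      (matA S K W θ)ᵀ * OmPair S K (matL K) (matL K) θ * matA S K W θ
        + (matB S K θ)ᵀ * OmPair S K (matL K) (matL K) θ * matB S K θ
        + (matA S K W θ)ᵀ * OmPair S K (matL K) W θ * matC S K W θ
        - (matC S K W θ)ᵀ * (OmPair S K (matL K) W θ)ᵀ * matA S K W θ := by
  have hU := hF.mapsTo
  have h1 : OmPair S K (matN S K W) (matN S K W) θ
      = (matA S K W θ)ᵀ * OmPair S K (matL K) (matN S K W) θ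
        + (matB S K θ)ᵀ * GPair S K (matL K) (matN S K W) θ
        + (matC S K W θ)ᵀ * OmPair S K W (matN S K W) θ := by
    have hc : (S.J (K θ))ᵀ * S.Om (K θ) = S.G (K θ) := S.compatible _ (hU θ)
    have hN : (matN S K W θ)ᵀ = (matA S K W θ)ᵀ * (matL K θ)ᵀ
        + (matB S K θ)ᵀ * ((matL K θ)ᵀ * (S.J (K θ))ᵀ) + (matC S K W θ)ᵀ * (W θ)ᵀ := by
      simp only [matN, Matrix.transpose_add, Matrix.transpose_mul]
    simp only [OmPair, GPair, ← hc, hN, Matrix.add_mul, Matrix.mul_assoc]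
  have h2 : GPair S K (matL K) (matN S K W) θ
      = GPair S K (matL K) (matL K) θ * matA S K W θ
        + OmPair S K (matL K) (matL K) θ * matB S K θ
        + GPair S K (matL K) W θ * matC S K W θ := by
    have h : S.G (K θ) * (S.J (K θ) * matL K θ * matB S K θ)
        = S.Om (K θ) * matL K θ * matB S K θ := by
      rw [← Matrix.mul_assoc, ← Matrix.mul_assoc, S.G_mul_J (hU θ)]
    rw [GPair, matN, Matrix.mul_assoc, Matrix.mul_add, Matrix.mul_add (S.G (K θ)), h]
    simp only [OmPair, GPair, Matrix.mul_add, Matrix.mul_assoc]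
  have h3 : (matB S K θ)ᵀ * GPair S K (matL K) (matL K) θ = 1 := by
    have := congrArg Matrix.transpose (GPair_mul_matB hF θ)
    rwa [Matrix.transpose_mul, GPair_transpose hU, Matrix.transpose_one] at this
  have h4 : (matB S K θ)ᵀ * GPair S K (matL K) W θ
      = -((matC S K W θ)ᵀ * OmPair S K W W θ) := by
    have := congrArg Matrix.transpose (OmPair_mul_matC hF θ)
    rw [Matrix.transpose_mul, Matrix.transpose_mul, GPair_transpose hU, OmPair_transpose,
      Matrix.mul_neg] at this
    exact this.symm
  rw [h1, h2, Matrix.mul_add, Matrix.mul_add, ← Matrix.mul_assoc, h3,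
    ← Matrix.mul_assoc _ (GPair S K (matL K) W θ), h4,
    Matrix.neg_mul, two_matA, Matrix.one_mul, OmPair_matL_matN hF, OmPair_W_matN hF,
    Matrix.mul_add, Matrix.mul_add, matA_transpose]
  simp only [Matrix.mul_neg, Matrix.mul_one, Matrix.neg_mul, Matrix.mul_assoc, neg_neg]
  abel

/-- The frame is symplectic up to `E_sym`. -/
theorem frameP_symplectic (hF : IsFrameData S K W) (θ : Fin d → ℝ) :
    (frameP S K W θ)ᵀ * S.Om (K θ) * frameP S K W θ
      = Matrix.fromBlocks (Matrix.J (Fin d) ℝ) 0 0 (OmPair S K W W θ) + errSym S K W θ := by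
  have hLN := OmPair_matL_matN hF θ
  have hNL : OmPair S K (matN S K W) (matL K) θ = 1
      + ((matA S K W θ)ᵀ * OmPair S K (matL K) (matL K) θ
        - (matC S K W θ)ᵀ * (OmPair S K (matL K) W θ)ᵀ) := by
    rw [← neg_neg (OmPair S K (matN S K W) (matL K) θ), ← OmPair_transpose, hLN]
    simp only [Matrix.transpose_add, Matrix.transpose_neg, Matrix.transpose_one,
      Matrix.transpose_mul, OmPair_transpose (matL K) (matL K), Matrix.mul_neg]
    abel
  have hWL : OmPair S K W (matL K) θ = -(OmPair S K (matL K) W θ)ᵀ := by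
    rw [OmPair_transpose, neg_neg]
  have hWN := OmPair_W_matN hF θ
  have hNW : OmPair S K (matN S K W) W θ = (matA S K W θ)ᵀ * OmPair S K (matL K) W θ := by
    rw [← neg_neg (OmPair S K (matN S K W) W θ), ← OmPair_transpose, hWN]
    simp [Matrix.transpose_mul]
  have hNN := OmPair_matN_matN hF θ
  ext x y
  rcases x with (i | i) | i <;> rcases y with (j | j) | j
  · exact (zero_add _).symm
  · exact congrFun (congrFun hLN i) j
  · exact (zero_add _).symm
  · exact congrFun (congrFun hNL i) j
  · exact (congrFun (congrFun hNN i) j).trans (zero_add _).symm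
  · exact (congrFun (congrFun hNW i) j).trans (zero_add _).symm
  · exact (congrFun (congrFun hWL i) j).trans (zero_add _).symm
  · exact (congrFun (congrFun hWN i) j).trans (zero_add _).symm
  · exact (add_zero _).symm

theorem matBound_errSym {ρ q p : ℝ} (hq : 0 ≤ q) (hp : 0 ≤ p) (hA : MatBound ρ (matA S K W) q)
    (hB : MatBound ρ (matB S K) q) (hC : MatBound ρ (matC S K W) q)
    (hLL : MatBound ρ (OmPair S K (matL K) (matL K)) p)
    (hLW : MatBound ρ (OmPair S K (matL K) W) p) :
    MatBound ρ (errSym S K W) ((1 + 2 * ((d : ℝ) * q) + (m + m : ℕ) * q + 2 * ((d : ℝ) ^ 2 * q ^ 2)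
      + 2 * ((d : ℝ) * (m + m : ℕ) * q ^ 2)) * p) := by
  have e1 : 0 ≤ (d : ℝ) * q * p := by positivity
  have e2 : 0 ≤ ((m + m : ℕ) : ℝ) * q * p := by positivity
  have e3 : 0 ≤ (d : ℝ) ^ 2 * q ^ 2 * p := by positivity
  have e4 : 0 ≤ (d : ℝ) * (m + m : ℕ) * q ^ 2 * p := by positivity
  have hLN := (hLL.mul hA).add (hLW.mul hC)
  have hNL := (hA.transpose.mul hLL).sub (hC.transpose.mul hLW.transpose)
  have hNN := (((hA.transpose.mul hLL).mul hA).add ((hB.transpose.mul hLL).mul hB)).add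
    ((hA.transpose.mul hLW).mul hC) |>.sub ((hC.transpose.mul hLW.transpose).mul hA)
  have hNW := hA.transpose.mul hLW
  have hWN := (hLW.transpose.mul hA).neg
  simp only [Fintype.card_fin, Fintype.card_sum] at hLN hNL hNN hNW hWN
  intro x y
  rcases x with (i | i) | i <;> rcases y with (j | j) | j
  · exact (hLL i j).mono (by linarith)
  · exact (hLN i j).mono (by linarith)
  · exact (hLW i j).mono (by linarith)
  · exact (hNL i j).mono (by linarith)
  · exact (hNN i j).mono (by linarith)
  · exact (hNW i j).mono (by linarith)
  · exact (hLW.transpose.neg i j).mono (by linarith)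
  · exact (hWN i j).mono (by linarith)
  · exact hasBound_zero.mono (by linarith)

/-- The matrices `A`, `B` and `C` are bounded on the strip in terms of `M`. -/
theorem exists_matBound_frame (n d m : ℕ) {ρ M : ℝ} (hM : 0 ≤ M) :
    ∃ q ≥ 0, ∀ (S : PhaseSpace n) (K : (Fin d → ℝ) → Fin (2 * n) → ℝ)
      (W : (Fin d → ℝ) → Matrix (Fin (2 * n)) (Fin m ⊕ Fin m) ℝ),
      MatBound ρ (matL K) M → MatBound ρ W M → MatBound ρ (matB S K) M →
      MatBound ρ (fun θ => (OmPair S K W W θ)⁻¹) M → MatBound ρ (fun θ => S.Om (K θ)) M →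
      MatBound ρ (fun θ => S.G (K θ)) M →
      MatBound ρ (matA S K W) q ∧ MatBound ρ (matB S K) q ∧ MatBound ρ (matC S K W) q := by
  set N : ℝ := ((2 * n : ℕ) : ℝ)
  set e : ℝ := ((m + m : ℕ) : ℝ)
  set g : ℝ := N * (N * (M * M) * M)
  set cC : ℝ := (d : ℝ) * (e * (M * g) * M)
  set cA : ℝ := |1 / 2| * (e * (e * (cC * g) * cC))
  refine ⟨M + (cA + cC), by positivity, fun S K W hL hW hB hWW hO hG => ?_⟩
  have hC := (hWW.mul ((hW.transpose.mul hG).mul hL)).mul hB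
  have hA := ((hC.transpose.mul ((hW.transpose.mul hO).mul hW)).mul hC).smul (1 / 2)
  simp only [Fintype.card_fin, Fintype.card_sum] at hA hC
  have h0 : 0 ≤ cC := by positivity
  have h1 : 0 ≤ cA := by positivity
  exact ⟨hA.mono (show cA ≤ _ by linarith), hB.mono (by linarith),
    hC.mono (show cC ≤ _ by linarith)⟩

end Frame

/-- The positivity of `c` matters for `e = ∞`, where `0 * ∞ = 0`. -/
theorem le_mul_of_forall_nnreal {x e : ℝ≥0∞} {c : ℝ≥0} (hc : 0 < c)
    (h : ∀ b : ℝ≥0, e < b → x ≤ c * b) : x ≤ c * e := by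
  refine ENNReal.le_of_forall_pos_le_add fun ε hε hlt => ?_
  have he : e ≠ ⊤ := by
    rintro rfl
    rw [ENNReal.mul_top (by exact_mod_cast hc.ne')] at hlt
    exact lt_irrefl _ hlt
  lift e to ℝ≥0 using he
  have hd : 0 < ε / c := div_pos hε hc
  refine (h (e + ε / c) (by exact_mod_cast lt_add_of_pos_right e hd)).trans_eq ?_
  norm_cast
  rw [mul_add, mul_div_cancel₀ _ hc.ne']

/-- The symplecticity error is controlled by the invariance errors. -/
theorem exists_stripNormMat_errSym_le (n : ℕ) {d m : ℕ} {ω : Fin d → ℝ} {β : Fin m → ℝ} {γ τ : ℝ}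
    (hDM : DiophantineMelnikov ω β γ τ) {ρ ρ' : ℝ} (hρ' : 0 < ρ') (hρ : ρ' < ρ) (M : ℝ≥0) :
    ∃ c : ℝ≥0, ∀ (S : PhaseSpace n) (h : (Fin (2 * n) → ℝ) → ℝ) (α : Fin m → ℝ)
      (K : (Fin d → ℝ) → Fin (2 * n) → ℝ)
      (W : (Fin d → ℝ) → Matrix (Fin (2 * n)) (Fin m ⊕ Fin m) ℝ),
      AnalyticOnNhd ℝ h S.U → IsFrameData S K W → BoundedBy S K W ρ M →
      stripNormMat ρ' (errSym S K W)
        ≤ c * (stripNormVec ρ (errK S h ω K) + stripNormMat ρ (errW S h ω α β K W)) := by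
  -- a bound `≤ M` on the infimum over the extensions gives an extension bounded by `M + 1`
  have hM : (0 : ℝ) ≤ ((M + 1 : ℝ≥0) : ℝ) := NNReal.coe_nonneg _
  have hlt : (M : ℝ≥0∞) < ((M + 1 : ℝ≥0) : ℝ≥0∞) := by
    exact_mod_cast lt_add_of_pos_right M one_pos
  obtain ⟨q, hq, hABC⟩ := exists_matBound_frame n d m (ρ := ρ) hM
  obtain ⟨c, hc, hOm⟩ := exists_matBound_OmPair n hDM hρ' hρ hM
  set T : ℝ := 1 + 2 * ((d : ℝ) * q) + (m + m : ℕ) * q + 2 * ((d : ℝ) ^ 2 * q ^ 2)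
      + 2 * ((d : ℝ) * (m + m : ℕ) * q ^ 2) with hT
  have hT0 : 0 ≤ T := by positivity
  refine ⟨Real.toNNReal (T * c + 1), fun S h α K W hh hF hB => ?_⟩
  refine le_mul_of_forall_nnreal (Real.toNNReal_pos.2 (by positivity)) fun b hb => ?_
  have hL := matBound_of_stripNormMat_lt (hB.L_le.trans_lt hlt)
  have hW := matBound_of_stripNormMat_lt (hB.W_le.trans_lt hlt)
  have hO := matBound_of_stripNormMat_lt (hB.Om_le.trans_lt hlt)
  obtain ⟨hA, hB', hC⟩ := hABC S K W hL hW (matBound_of_stripNormMat_lt (hB.B_le.trans_lt hlt))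
    (matBound_of_stripNormMat_lt (hB.OmWW_inv_le.trans_lt hlt)) hO
    (matBound_of_stripNormMat_lt (hB.G_le.trans_lt hlt))
  obtain ⟨hLL, hLW⟩ := hOm S h α K W b hh hF hL hW hO
    (fun k => matBound_of_stripNormMat_lt ((hB.DOm_le k).trans_lt hlt))
    (fun i => hasBound_of_stripNorm_lt
      (((le_iSup (fun i => stripNorm ρ fun θ => errK S h ω K θ i) i).trans
        le_self_add).trans_lt hb))
    (matBound_of_stripNormMat_lt (le_add_self.trans_lt hb))
  have hfin := matBound_errSym hq (by positivity) (hA.restrict hρ.le) (hB'.restrict hρ.le)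
    (hC.restrict hρ.le) hLL hLW
  rw [← hT] at hfin
  refine hfin.stripNormMat_le.trans ?_
  rw [← mul_assoc, ENNReal.ofReal_mul (by positivity), ENNReal.ofReal_coe_nnreal]
  gcongr
  exact ENNReal.ofReal_le_ofReal (by linarith)

end EllipticTorus

theorem mainTheorem3 (n d : ℕ) (hd : d < n) :
    -- `P` is symplectic up to the explicit error `E_sym`
    (∀ (S : EllipticTorus.PhaseSpace n) (K : (Fin d → ℝ) → Fin (2 * n) → ℝ)
        (W : (Fin d → ℝ) → Matrix (Fin (2 * n)) (Fin (n - d) ⊕ Fin (n - d)) ℝ),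
        EllipticTorus.IsFrameData S K W →
        ∀ θ : Fin d → ℝ,
          (EllipticTorus.frameP S K W θ)ᵀ * S.Om (K θ) * EllipticTorus.frameP S K W θ
            = Matrix.fromBlocks (Matrix.J (Fin d) ℝ) 0 0 (EllipticTorus.OmPair S K W W θ)
              + EllipticTorus.errSym S K W θ) ∧
    -- `E_sym = O(E_K, E_W)`
    (∀ (ω : Fin d → ℝ) (β : Fin (n - d) → ℝ) (γ τ : ℝ),
        EllipticTorus.DiophantineMelnikov ω β γ τ →
        ∀ (ρ ρ' : ℝ), 0 < ρ' → ρ' < ρ → ∀ M : ℝ≥0,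
        ∃ c : ℝ≥0,
          ∀ (S : EllipticTorus.PhaseSpace n)
            (h : (Fin (n - d) → ℝ) → (Fin (2 * n) → ℝ) → ℝ)
            (lam α : Fin (n - d) → ℝ)
            (K : (Fin d → ℝ) → Fin (2 * n) → ℝ)
            (W : (Fin d → ℝ) → Matrix (Fin (2 * n)) (Fin (n - d) ⊕ Fin (n - d)) ℝ),
            (∀ l, AnalyticOnNhd ℝ (h l) S.U) →
            EllipticTorus.IsFrameData S K W →
            EllipticTorus.BoundedBy S K W ρ M →
            EllipticTorus.stripNormMat ρ' (EllipticTorus.errSym S K W)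
              ≤ c * (EllipticTorus.stripNormVec ρ (EllipticTorus.errK S (h lam) ω K)
                + EllipticTorus.stripNormMat ρ (EllipticTorus.errW S (h lam) ω α β K W))) := by
  refine ⟨fun S K W hF θ => EllipticTorus.frameP_symplectic hF θ, ?_⟩
  intro ω β γ τ hDM ρ ρ' hρ' hρ M
  obtain ⟨c, hc⟩ := EllipticTorus.exists_stripNormMat_errSym_le n hDM hρ' hρ M
  exact ⟨c, fun S h lam α K W hh hF hB => hc S (h lam) α K W (hh lam) hF hB⟩
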